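/- **Setting.** Let $X$ be a finite set, $\mathcal F\subseteq 2^X$, and let $f:2^X\to\mathbb R_{\ge 0}$ be submodular (optionally: monotone submodular), i.e. $f(S\cup T)+f(S\cap T)\le f(S)+f(T)$ for all $S,T\subseteq X$ (and optionally $f(S)\le f(T)$ whenever $S\subseteq T$). Let $\mathcal G$ be a group of permutations of $X$, and for $\mathbf x\in\mathbb R^X$ let $\bar{\mathbf x}=\mathbf E_{\sigma\in\mathcal G}[\sigma(\mathbf x)]$ with $\sigma\in\mathcal G$ uniformly random, where $\sigma$ permutes coordinates so that $\sigma(\mathbf 1_S)=\mathbf 1_{\sigma(S)}$. Assume that the instance $\max\{f(S):S\in\mathcal F\}$ is *strongly symmetric* with respect to $\mathcal G$: $f(\sigma(S))=f(S)$ for all $\sigma\in\mathcal G$, $S\subseteq X$, and $S\in\mathcal F\Leftrightarrow S'\in\mathcal F$ whenever $\overline{\mathbf 1_S}=\overline{\mathbf 1_{S'}}$. Let $F(\mathbf x)=\sum_{S\subseteq X}f(S)\prod_{i\in S}x_i\prod_{j\notin S}(1-x_j)$ be the multilinear extension of $f$ and let $P(\mathcal F)=\operatorname{conv}\{\mathbf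 1_S:S\in\mathcal F\}$. Put $$OPT=\max_{\mathbf x\in P(\mathcal F)}F(\mathbf x),\qquad \overline{OPT}=\max_{\mathbf x\in P(\mathcal F)}F(\bar{\mathbf x}),\qquad \gamma=\overline{OPT}/OPT,$$ where $OPT>0$ is assumed, so that the symmetry gap $\gamma$ is defined. For $n\ge1$ and $N=[n]$, the *refinement* of $\mathcal F$ to $N\times X$ is the family $\tilde{\mathcal F}$ of all $S\subseteq N\times X$ such that the vector with coordinates $x_j=\frac1n|S\cap(N\times\{j\})|$, $j\in X$, lies in $P(\mathcal F)$. Let $\mathcal C_n$ be the class of all instances $\max\{g(S):S\in\tilde{\mathcal F}\}$ where $g:2^{N\times X}\to\mathbb R_{\ge0}$ is submodular (optionally: monotone submodular, if $f$ was assumed to be so). A randomized algorithm on $N\times X$ is a random adaptive decision tree that queries values $g(Q)$, $Q\subseteq N\times X$, and finally returns a subset of $N\times X$; it may depend on $n$, $f$, $\mathcal F$ and $\mathcal G$, and its computational power is unlimited. **Theorem.** For every $\epsilon>0$ there is a constant $c>0$ (depending only on $f,\mathcal F,\mathcal G,\epsilon$ and on whether monotonicity is required) such that the following hold. 1. For every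 $p>0$ there is $n_0$ such that for all $n\ge n_0$: if a randomized algorithm returns, on every instance of $\mathcal C_n$, with probability at least $p$ a set $S\in\tilde{\mathcal F}$ with $g(S)\ge(1+\epsilon)\gamma\cdot\max\{g(T):T\in\tilde{\mathcal F}\}$, then on some instance of $\mathcal C_n$ its expected number of value queries is at least $e^{cn}$. 2. There is $n_0$ such that for all $n\ge n_0$: if a randomized algorithm returns, on every instance of $\mathcal C_n$, almost surely a set $S\in\tilde{\mathcal F}$, and $\mathbf E[g(S)]\ge(1+\epsilon)\gamma\cdot\max\{g(T):T\in\tilde{\mathcal F}\}$, then on some instance of $\mathcal C_n$ its expected number of value queries is at least $e^{cn}$. -/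

import Mathlib

open scoped ENNReal

namespace SymmetryGap

section SetFunctions

/-- A set function on a finite ground set is submodular. -/
def IsSubmodular {E : Type*} [DecidableEq E] (f : Finset E → ℝ) : Prop :=
  ∀ S T : Finset E, f (S ∪ T) + f (S ∩ T) ≤ f S + f T

/-- Nonnegative (optionally monotone) submodular objective functions. The parameter `mono` says
whether monotonicity is required: for `mono = False` these are the nonnegative submodular
functions, for `mono = True` the nonnegative monotone submodular functions. -/
def IsObjective {E : Type*} [DecidableEq E] (mono : Prop) (f : Finset E → ℝ) : Prop :=
  (∀ S, 0 ≤ f S) ∧ IsSubmodular f ∧ (mono → Monotone f)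

/-- The optimum `max {f(S) : S ∈ ℱ}` of a discrete instance on a finite ground set. -/
noncomputable def optValue {E : Type*} (f : Finset E → ℝ) (ℱ : Set (Finset E)) : ℝ :=
  sSup (f '' ℱ)

end SetFunctions

section Gap

variable {X : Type*} [Fintype X] [DecidableEq X]

/-- The characteristic vector of a set. -/
def charVec (S : Finset X) : X → ℝ := fun j => if j ∈ S then 1 else 0

/-- The polytope `P(ℱ)`: the convex hull of the characteristic vectors of the feasible sets. -/
def polytope (ℱ : Set (Finset X)) : Set (X → ℝ) := convexHull ℝ (charVec '' ℱ)

/-- The multilinear extension `F(x) = ∑_S f(S) ∏_{i ∈ S} x_i ∏_{j ∉ S} (1 - x_j)`. -/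
def multilinearExt (f : Finset X → ℝ) (x : X → ℝ) : ℝ :=
  ∑ S : Finset X, f S * ((∏ i ∈ S, x i) * ∏ j ∈ Sᶜ, (1 - x j))

open scoped Classical in
/-- The symmetrization `x̄ = 𝔼_{σ ∈ G} [σ(x)]`, where `σ(x)` has the coordinates of `x` permuted by
`σ`, so that `σ(1_S) = 1_{σ(S)}`. -/
noncomputable def symmetrize (G : Subgroup (Equiv.Perm X)) (x : X → ℝ) : X → ℝ :=
  fun j => (∑ σ : G, x ((σ : Equiv.Perm X)⁻¹ j)) / (Nat.card G : ℝ)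

/-- The instance `max {f(S) : S ∈ ℱ}` is strongly symmetric with respect to `G`: the objective
is invariant under `G`, and whether `S` is feasible depends only on the symmetrization of the
characteristic vector of `S`. -/
def StronglySymmetric (f : Finset X → ℝ) (ℱ : Set (Finset X))
    (G : Subgroup (Equiv.Perm X)) : Prop :=
  (∀ σ ∈ G, ∀ S : Finset X, f (S.map σ.toEmbedding) = f S) ∧
  (∀ S T : Finset X, symmetrize G (charVec S) = symmetrize G (charVec T) → (S ∈ ℱ ↔ T ∈ ℱ))

/-- `OPT = max {F(x) : x ∈ P(ℱ)}`. -/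
noncomputable def opt (f : Finset X → ℝ) (ℱ : Set (Finset X)) : ℝ :=
  sSup (multilinearExt f '' polytope ℱ)

/-- The symmetric optimum `max {F(x̄) : x ∈ P(ℱ)}`. -/
noncomputable def symOpt (f : Finset X → ℝ) (ℱ : Set (Finset X))
    (G : Subgroup (Equiv.Perm X)) : ℝ :=
  sSup ((fun x => multilinearExt f (symmetrize G x)) '' polytope ℱ)

/-- The symmetry gap: the ratio of the symmetric optimum to `OPT`. -/
noncomputable def symmetryGap (f : Finset X → ℝ) (ℱ : Set (Finset X))
    (G : Subgroup (Equiv.Perm X)) : ℝ :=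
  symOpt f ℱ G / opt f ℱ

/-- The fraction of the cluster `N × {j}` that is contained in `S`. -/
noncomputable def clusterFraction (N : Type*) [Fintype N] (S : Finset (N × X)) : X → ℝ :=
  fun j => ((S.filter fun e => e.2 = j).card : ℝ) / (Fintype.card N : ℝ)

/-- The refinement of `ℱ` to the ground set `N × X`: the sets whose vector of cluster fractions
lies in the polytope `P(ℱ)`. -/
def refinement (N : Type*) [Fintype N] (ℱ : Set (Finset X)) : Set (Finset (N × X)) :=
  {S | clusterFraction N S ∈ polytope ℱ}

end Gap

section Algorithms

/-- A deterministic algorithm with access to a value oracle on the ground set `E`, with unlimited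
computational power: an adaptive decision tree. At each step it either stops and returns a set, or
it queries the value of some set and continues depending on the real number it is told. -/
inductive QueryTree (E : Type*) : Type _
  | output (S : Finset E) : QueryTree E
  | query (Q : Finset E) (next : ℝ → QueryTree E) : QueryTree E

/-- The set returned by a deterministic algorithm when the oracle is `g`. -/
def QueryTree.result {E : Type*} (g : Finset E → ℝ) : QueryTree E → Finset E
  | .output S => S
  | .query Q next => (next (g Q)).result g

/-- The number of value queries made by a deterministic algorithm when the oracle is `g`. -/
def QueryTree.cost {E : Type*} (g : Finset E → ℝ) : QueryTree E → ℕ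
  | .output _ => 0
  | .query Q next => (next (g Q)).cost g + 1

/-- A randomized algorithm in the value oracle model: a random deterministic algorithm, such that
for every oracle the returned set and the number of queries are random variables. -/
structure RandomizedAlgorithm (E : Type*) where
  /-- The space of random seeds. -/
  Ω : Type*
  /-- The σ-algebra on the random seeds. -/
  measΩ : MeasurableSpace Ω
  /-- The distribution of the random seed. -/
  P : MeasureTheory.Measure Ω
  isProb : MeasureTheory.IsProbabilityMeasure P
  /-- The deterministic algorithm that is run with a given seed. -/
  tree : Ω → QueryTree E
  measurable_result : ∀ (g : Finset E → ℝ) (S : Finset E),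
    MeasurableSet {ω | (tree ω).result g = S}
  measurable_cost : ∀ (g : Finset E → ℝ) (k : ℕ), MeasurableSet {ω | (tree ω).cost g = k}

namespace RandomizedAlgorithm

variable {E : Type*}

/-- The expected number of value queries made when the oracle is `g`. -/
noncomputable def expectedQueries (A : RandomizedAlgorithm E) (g : Finset E → ℝ) : ℝ≥0∞ :=
  letI := A.measΩ
  ∫⁻ ω, ((A.tree ω).cost g : ℝ≥0∞) ∂A.P

/-- `A` is an `α`-approximation algorithm with success probability at least `p` for
the instances `max {g(S) : S ∈ 𝓕}` with `g ∈ 𝓞`: on each of them it returns, with probability at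
least `p`, a feasible set of value at least `α` times the optimum. -/
def IsApproxWithProb (A : RandomizedAlgorithm E) (𝓞 : Set (Finset E → ℝ))
    (𝓕 : Set (Finset E)) (α p : ℝ) : Prop :=
  letI := A.measΩ
  ∀ g ∈ 𝓞, ENNReal.ofReal p ≤
    A.P {ω | (A.tree ω).result g ∈ 𝓕 ∧ α * optValue g 𝓕 ≤ g ((A.tree ω).result g)}

/-- `A` is an `α`-approximation algorithm in expectation for the instances
`max {g(S) : S ∈ 𝓕}` with `g ∈ 𝓞`: on each of them it almost surely returns a feasible set, whose
expected value is at least `α` times the optimum. -/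
def IsApproxInExpectation (A : RandomizedAlgorithm E) (𝓞 : Set (Finset E → ℝ))
    (𝓕 : Set (Finset E)) (α : ℝ) : Prop :=
  letI := A.measΩ
  ∀ g ∈ 𝓞, (∀ᵐ ω ∂A.P, (A.tree ω).result g ∈ 𝓕) ∧
    α * optValue g 𝓕 ≤ ∫ ω, g ((A.tree ω).result g) ∂A.P

end RandomizedAlgorithm

end Algorithms

end SymmetryGap

open SymmetryGap

namespace SymmetryGap

/-! ### Calculus along lines -/

section LineDerivative

variable {V : Type*} [AddCommGroup V] [Module ℝ V]

/-! A secret choice of one permutation per row hides the good solutions, and an algorithm with few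
queries sees only the symmetrized objective.

Let F be the multilinear extension of f. `exists_symmetric_perturbation` replaces F by a function Φ
on the cube that is uniformly close to F, has diminishing returns (and is monotone if required), and
satisfies Φ(x) = Φ(x̄) whenever x is close to x̄. It has the form Φ = F − φ(D)(F − F̄) + κJ, where
F̄(x) = F(x̄), D(x) = ‖x − x̄‖² and φ is a cutoff. Since f is invariant, the gradient of F at a
symmetric point is invariant, so F − F̄ is quadratic and its gradient linear in the asymmetry of x.
If φ decreases slowly on a logarithmic scale, the derivatives of φ(D) contribute only small errors
to the mixed second derivatives; these are absorbed by the strictly negative mixed derivatives of J.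

For σ : N → G let h_σ(S) be the value of Φ at the cluster fractions of S after row i has been
permuted by σ i, and let g(S) be the value of Φ at the symmetrized cluster fractions. Functions with
diminishing returns composed with modular maps are submodular. On feasible sets g is at most about
the symmetric optimum, while every h_σ has optimum at least about OPT: a near-optimal point of the
polytope is rounded to an average of feasible sets, which are hidden in the rows.

For a fixed query Q and random σ, each permuted cluster fraction is an average of independent
variables whose mean is the symmetrized fraction, which does not depend on σ. By Hoeffding, h_σ(Q) =
g(Q) except with exponentially small probability. A union bound along the run on g, averaged over σ,
gives for each algorithm with few expected queries on g some σ for which the run on h_σ almost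
always returns the same set, with the same value (`exists_prob_distinguishes_le`). That value is too
small for h_σ. Hence g itself forces exponentially many queries. -/

theorem hasDerivAt_line {A A' : V → ℝ} {u : V} (h : ∀ y, HasLineDerivAt ℝ A (A' y) y u)
    (x : V) (s : ℝ) : HasDerivAt (fun t : ℝ => A (x + t • u)) (A' (x + s • u)) s := by
  have h1 : HasDerivAt (fun t : ℝ => A (x + s • u + t • u)) (A' (x + s • u)) (s - s) := by
    rw [sub_self]; exact h (x + s • u)
  have h2 := HasDerivAt.comp_sub_const s s h1
  refine h2.congr_of_eventuallyEq (Filter.Eventually.of_forall fun t => ?_)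
  simp only [add_assoc, ← add_smul, add_sub_cancel]

theorem le_add_of_hasLineDerivAt_nonneg {A A' : V → ℝ} {u : V}
    (h : ∀ y, HasLineDerivAt ℝ A (A' y) y u) (x : V)
    (hA : ∀ s ∈ Set.Icc (0 : ℝ) 1, 0 ≤ A' (x + s • u)) : A x ≤ A (x + u) := by
  have hd := hasDerivAt_line h x
  have hm : MonotoneOn (fun t : ℝ => A (x + t • u)) (Set.Icc 0 1) :=
    monotoneOn_of_deriv_nonneg (convex_Icc 0 1)
      (fun s _ => (hd s).continuousAt.continuousWithinAt)
      (fun s _ => (hd s).differentiableAt.differentiableWithinAt)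
      (fun s hs => by rw [(hd s).deriv]; exact hA s (interior_subset hs))
  simpa using hm (Set.left_mem_Icc.2 zero_le_one) (Set.right_mem_Icc.2 zero_le_one) zero_le_one

theorem add_le_of_hasLineDerivAt_nonpos {A A' : V → ℝ} {u : V}
    (h : ∀ y, HasLineDerivAt ℝ A (A' y) y u) (x : V)
    (hA : ∀ s ∈ Set.Icc (0 : ℝ) 1, A' (x + s • u) ≤ 0) : A (x + u) ≤ A x := by
  have := le_add_of_hasLineDerivAt_nonneg (A := fun y => - A y) (A' := fun y => - A' y)
    (fun y => HasDerivAt.neg (h y)) x (fun s hs => neg_nonneg.2 (hA s hs))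
  linarith

theorem abs_sub_le_of_hasLineDerivAt {A A' : V → ℝ} {u : V} {C : ℝ}
    (h : ∀ y, HasLineDerivAt ℝ A (A' y) y u) (x : V)
    (hA : ∀ s ∈ Set.Icc (0 : ℝ) 1, |A' (x + s • u)| ≤ C) : |A (x + u) - A x| ≤ C := by
  have := norm_image_sub_le_of_norm_deriv_le_segment_01'
    (f := fun t : ℝ => A (x + t • u)) (f' := fun t => A' (x + t • u)) (C := C)
    (fun s _ => (hasDerivAt_line h x s).hasDerivWithinAt)
    (fun s hs => hA s (Set.Ico_subset_Icc_self hs))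
  simpa using this

/-- A function whose mixed second derivatives in the directions `u`, `v` are nonpositive has
diminishing returns in these directions. -/
theorem diminishing_returns_of_mixed_deriv_nonpos {A A₁ A₂ : V → ℝ} {u v : V}
    (h₁ : ∀ y, HasLineDerivAt ℝ A (A₁ y) y u) (h₂ : ∀ y, HasLineDerivAt ℝ A₁ (A₂ y) y v) (x : V)
    (hA : ∀ s ∈ Set.Icc (0 : ℝ) 1, ∀ t ∈ Set.Icc (0 : ℝ) 1, A₂ (x + s • u + t • v) ≤ 0) :
    A (x + u + v) + A x ≤ A (x + u) + A (x + v) := by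
  have key := add_le_of_hasLineDerivAt_nonpos (A := fun y => A (y + v) - A y)
    (A' := fun y => A₁ (y + v) - A₁ y) (u := u) (fun y => by
      refine HasDerivAt.sub ?_ (h₁ y)
      have := h₁ (y + v)
      unfold HasLineDerivAt at this
      simpa only [add_right_comm] using this) x (fun s hs => by
      have := add_le_of_hasLineDerivAt_nonpos h₂ (x + s • u) (hA s hs)
      linarith)
  linarith

end LineDerivative

/-! ### Derivatives of the multilinear extension -/

section Multilinear

variable {X : Type*} [Fintype X] [DecidableEq X]

/-- The probability of the set `S` if every `i` is included independently with probability
`x i`. -/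
def weight (S : Finset X) (x : X → ℝ) : ℝ := ∏ i, if i ∈ S then x i else 1 - x i

theorem multilinearExt_eq_sum_weight (f : Finset X → ℝ) (x : X → ℝ) :
    multilinearExt f x = ∑ S, f S * weight S x := by
  unfold multilinearExt weight
  refine Finset.sum_congr rfl fun S _ => ?_
  congr 1
  rw [Finset.prod_ite]
  congr 1
  · exact Finset.prod_congr (by ext; simp) fun _ _ => rfl
  · exact Finset.prod_congr (by ext; simp) fun _ _ => rfl

theorem weight_nonneg (S : Finset X) {x : X → ℝ} (h0 : 0 ≤ x) (h1 : x ≤ 1) : 0 ≤ weight S x :=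
  Finset.prod_nonneg fun i _ => by
    split_ifs
    · exact h0 i
    · exact sub_nonneg.2 (h1 i)

theorem sum_weight (x : X → ℝ) : ∑ S, weight S x = 1 := by
  have := Finset.prod_add x (fun i => 1 - x i) (Finset.univ)
  simp only [add_sub_cancel, Finset.prod_const_one, Finset.powerset_univ] at this
  rw [this]
  refine Finset.sum_congr rfl fun S _ => ?_
  unfold weight
  rw [Finset.prod_ite]
  congr 1
  · exact Finset.prod_congr (by ext; simp) fun _ _ => rfl
  · exact Finset.prod_congr (by ext; simp) fun _ _ => rfl

theorem multilinearExt_nonneg {f : Finset X → ℝ} (hf : ∀ S, 0 ≤ f S) {x : X → ℝ} (h0 : 0 ≤ x)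
    (h1 : x ≤ 1) : 0 ≤ multilinearExt f x := by
  rw [multilinearExt_eq_sum_weight]
  exact Finset.sum_nonneg fun S _ => mul_nonneg (hf S) (weight_nonneg S h0 h1)

theorem multilinearExt_nonpos {f : Finset X → ℝ} (hf : ∀ S, f S ≤ 0) {x : X → ℝ} (h0 : 0 ≤ x)
    (h1 : x ≤ 1) : multilinearExt f x ≤ 0 := by
  rw [multilinearExt_eq_sum_weight]
  exact Finset.sum_nonpos fun S _ => mul_nonpos_of_nonpos_of_nonneg (hf S) (weight_nonneg S h0 h1)

theorem abs_multilinearExt_le {f : Finset X → ℝ} {M : ℝ} (hf : ∀ S, |f S| ≤ M) {x : X → ℝ}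
    (h0 : 0 ≤ x) (h1 : x ≤ 1) : |multilinearExt f x| ≤ M := by
  rw [multilinearExt_eq_sum_weight]
  calc |∑ S, f S * weight S x| ≤ ∑ S, |f S * weight S x| := Finset.abs_sum_le_sum_abs _ _
    _ ≤ ∑ S, M * weight S x := Finset.sum_le_sum fun S _ => by
        rw [abs_mul, abs_of_nonneg (weight_nonneg S h0 h1)]
        exact mul_le_mul_of_nonneg_right (hf S) (weight_nonneg S h0 h1)
    _ = M := by rw [← Finset.mul_sum, sum_weight, mul_one]

theorem continuous_multilinearExt (f : Finset X → ℝ) : Continuous (multilinearExt f) := by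
  unfold multilinearExt; fun_prop

/-- The marginal value of `k` as a set function. -/
def marginal (k : X) (f : Finset X → ℝ) (S : Finset X) : ℝ := f (insert k S) - f (S.erase k)

/-- The left side is the partial derivative in coordinate k. Pairing each S without k with `insert k
S` gives the claim: the weights of the pair add up to the product over the other coordinates, and
the marginal is constant on the pair. -/
theorem sum_mul_signed_prod_erase (f : Finset X → ℝ) (x : X → ℝ) (k : X) :
    ∑ S, f S * ((∏ i ∈ Finset.univ.erase k, if i ∈ S then x i else 1 - x i) *
      (if k ∈ S then 1 else -1)) = multilinearExt (marginal k f) x := by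
  have hu : (Finset.univ : Finset (Finset X)) =
      (insert k ((Finset.univ : Finset X).erase k)).powerset := by simp
  rw [multilinearExt_eq_sum_weight, hu, Finset.sum_powerset_insert (Finset.notMem_erase k _),
    Finset.sum_powerset_insert (Finset.notMem_erase k _), ← Finset.sum_add_distrib,
    ← Finset.sum_add_distrib]
  refine Finset.sum_congr rfl fun S hS => ?_
  have hk : k ∉ S := fun h => Finset.notMem_erase k _ (Finset.mem_powerset.1 hS h)
  have hw : ∀ T : Finset X, weight T x =
      (∏ i ∈ Finset.univ.erase k, if i ∈ T then x i else 1 - x i) *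
        (if k ∈ T then x k else 1 - x k) := fun T =>
    (Finset.prod_erase_mul _ _ (Finset.mem_univ k)).symm
  have hp : (∏ i ∈ Finset.univ.erase k, if i ∈ insert k S then x i else 1 - x i) =
      ∏ i ∈ Finset.univ.erase k, if i ∈ S then x i else 1 - x i :=
    Finset.prod_congr rfl fun i hi => by
      simp [Finset.mem_insert, Finset.ne_of_mem_erase hi]
  rw [hw, hw, hp]
  simp only [marginal, Finset.mem_insert_self, if_true, hk, if_false, Finset.insert_idem,
    Finset.erase_insert hk, Finset.erase_eq_of_notMem hk]
  ring

/-- The derivative of the multilinear extension in the direction `u`. -/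
def multilinearDeriv (f : Finset X → ℝ) (u x : X → ℝ) : ℝ :=
  ∑ k, u k * multilinearExt (marginal k f) x

theorem hasLineDerivAt_multilinearExt (f : Finset X → ℝ) (u x : X → ℝ) :
    HasLineDerivAt ℝ (multilinearExt f) (multilinearDeriv f u x) x u := by
  have hlin : ∀ i : X, HasDerivAt (fun t : ℝ => x i + t * u i) (u i) 0 := fun i => by
    simpa using ((hasDerivAt_id (0 : ℝ)).mul_const (u i)).const_add (x i)
  have hw : ∀ S : Finset X, HasDerivAt (fun t : ℝ => weight S (x + t • u))
      (∑ k, (∏ i ∈ Finset.univ.erase k, if i ∈ S then x i else 1 - x i) *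
        (if k ∈ S then u k else - u k)) 0 := fun S => by
    have := HasDerivAt.fun_finsetProd (u := (Finset.univ : Finset X)) (x := (0 : ℝ))
      (f := fun i t => if i ∈ S then x i + t * u i else 1 - (x i + t * u i))
      (f' := fun i => if i ∈ S then u i else - u i) (fun i _ => by
        split_ifs
        · exact hlin i
        · exact (hlin i).const_sub 1)
    simpa [weight] using this
  unfold HasLineDerivAt
  have h := HasDerivAt.fun_sum (u := (Finset.univ : Finset (Finset X)))
    (fun S _ => (hw S).const_mul (f S))
  simp only [multilinearExt_eq_sum_weight f]
  convert h using 1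
  unfold multilinearDeriv
  simp_rw [← sum_mul_signed_prod_erase, Finset.mul_sum]
  rw [Finset.sum_comm]
  refine Finset.sum_congr rfl fun S _ => Finset.sum_congr rfl fun k _ => ?_
  split_ifs <;> ring

/-- The second derivative of the multilinear extension in the directions `u` and `v`. -/
def multilinearDeriv₂ (f : Finset X → ℝ) (u v x : X → ℝ) : ℝ :=
  ∑ k, u k * multilinearDeriv (marginal k f) v x

theorem hasLineDerivAt_multilinearDeriv (f : Finset X → ℝ) (u v x : X → ℝ) :
    HasLineDerivAt ℝ (multilinearDeriv f u) (multilinearDeriv₂ f u v x) x v :=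
  HasDerivAt.fun_sum fun k _ =>
    (hasLineDerivAt_multilinearExt (marginal k f) v x).const_mul (u k)

/-- For k ≠ l this is submodularity for two sets that differ in k and l. For k = l the value is
zero, because a marginal in k does not depend on k; thus diagonal second derivatives cause no
trouble. -/
theorem marginal_marginal_nonpos {f : Finset X → ℝ} (hf : IsSubmodular f) (k l : X)
    (S : Finset X) : marginal l (marginal k f) S ≤ 0 := by
  unfold marginal
  by_cases h : k = l
  · subst h
    have e : insert k (S.erase k) = insert k S := by
      ext a; simp only [Finset.mem_insert, Finset.mem_erase]; tauto
    simp [e]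
  have := hf (insert k (S.erase l)) ((insert l S).erase k)
  have e1 : insert k (S.erase l) ∪ (insert l S).erase k = insert k (insert l S) := by
    ext a; simp only [Finset.mem_union, Finset.mem_insert, Finset.mem_erase]; tauto
  have e2 : insert k (S.erase l) ∩ (insert l S).erase k = (S.erase l).erase k := by
    ext a; simp only [Finset.mem_inter, Finset.mem_insert, Finset.mem_erase]; tauto
  rw [e1, e2] at this
  linarith

theorem multilinearDeriv_nonneg {f : Finset X → ℝ} (hf : Monotone f) {u x : X → ℝ} (hu : 0 ≤ u)
    (h0 : 0 ≤ x) (h1 : x ≤ 1) : 0 ≤ multilinearDeriv f u x :=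
  Finset.sum_nonneg fun k _ => mul_nonneg (hu k) (multilinearExt_nonneg (fun S =>
    sub_nonneg.2 (hf ((Finset.erase_subset k S).trans (Finset.subset_insert k S)))) h0 h1)

theorem multilinearDeriv₂_nonpos {f : Finset X → ℝ} (hf : IsSubmodular f) {u v x : X → ℝ}
    (hu : 0 ≤ u) (hv : 0 ≤ v) (h0 : 0 ≤ x) (h1 : x ≤ 1) : multilinearDeriv₂ f u v x ≤ 0 :=
  Finset.sum_nonpos fun k _ => mul_nonpos_of_nonneg_of_nonpos (hu k) <|
    Finset.sum_nonpos fun l _ => mul_nonpos_of_nonneg_of_nonpos (hv l) <|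
      multilinearExt_nonpos (marginal_marginal_nonpos hf k l) h0 h1

theorem abs_multilinearDeriv₂_le {f : Finset X → ℝ} {M : ℝ}
    (hM : ∀ k l S, |marginal l (marginal k f) S| ≤ M) (u v : X → ℝ) {x : X → ℝ}
    (h0 : 0 ≤ x) (h1 : x ≤ 1) :
    |multilinearDeriv₂ f u v x| ≤ M * (∑ i, |u i|) * ∑ i, |v i| := by
  unfold multilinearDeriv₂ multilinearDeriv
  calc _ ≤ ∑ k, |u k| * ∑ l, |v l| * M := by
        refine (Finset.abs_sum_le_sum_abs _ _).trans (Finset.sum_le_sum fun k _ => ?_)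
        rw [abs_mul]
        refine mul_le_mul_of_nonneg_left ?_ (abs_nonneg _)
        refine (Finset.abs_sum_le_sum_abs _ _).trans (Finset.sum_le_sum fun l _ => ?_)
        rw [abs_mul]
        exact mul_le_mul_of_nonneg_left (abs_multilinearExt_le (hM k l) h0 h1) (abs_nonneg _)
    _ = _ := by rw [← Finset.sum_mul, ← Finset.sum_mul]; ring

end Multilinear

/-! ### The symmetrization operator -/

section Symmetrize

variable {X : Type*} [Fintype X] [DecidableEq X] (G : Subgroup (Equiv.Perm X))

theorem symmetrize_apply [Fintype G] (x : X → ℝ) (j : X) :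
    symmetrize G x j = (∑ σ : G, x ((σ : Equiv.Perm X)⁻¹ j)) / Fintype.card G := by
  unfold symmetrize
  rw [Nat.card_eq_fintype_card]
  congr!

theorem symmetrize_add (x y : X → ℝ) : symmetrize G (x + y) = symmetrize G x + symmetrize G y := by
  classical
  ext j
  simp only [symmetrize_apply, Pi.add_apply, Finset.sum_add_distrib, add_div]

theorem symmetrize_smul (t : ℝ) (x : X → ℝ) : symmetrize G (t • x) = t • symmetrize G x := by
  classical
  ext j
  simp only [symmetrize_apply, Pi.smul_apply, smul_eq_mul, ← Finset.mul_sum, mul_div_assoc]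

theorem symmetrize_mono {x y : X → ℝ} (h : x ≤ y) : symmetrize G x ≤ symmetrize G y := by
  classical
  intro j
  simp only [symmetrize_apply]
  gcongr
  exact h _

theorem symmetrize_one : symmetrize G (1 : X → ℝ) = 1 := by
  classical
  ext j
  simp [symmetrize_apply]

theorem symmetrize_zero : symmetrize G (0 : X → ℝ) = 0 := by
  simpa using symmetrize_smul G 0 (0 : X → ℝ)

theorem symmetrize_nonneg {x : X → ℝ} (h : 0 ≤ x) : 0 ≤ symmetrize G x :=
  symmetrize_zero G ▸ symmetrize_mono G h

theorem symmetrize_le_one {x : X → ℝ} (h : x ≤ 1) : symmetrize G x ≤ 1 :=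
  symmetrize_one G ▸ symmetrize_mono G h

theorem symmetrize_perm (x : X → ℝ) {τ : Equiv.Perm X} (hτ : τ ∈ G) (j : X) :
    symmetrize G x (τ j) = symmetrize G x j := by
  classical
  simp only [symmetrize_apply]
  congr 1
  refine Fintype.sum_equiv (Equiv.mulLeft (⟨τ, hτ⟩ : G)⁻¹) _ _ fun σ => ?_
  simp

theorem symmetrize_of_invariant {x : X → ℝ} (h : ∀ σ ∈ G, ∀ j, x (σ j) = x j) :
    symmetrize G x = x := by
  classical
  ext j
  simp only [symmetrize_apply]
  rw [Finset.sum_congr rfl fun σ _ => h _ (inv_mem σ.2) j]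
  simp

theorem symmetrize_symmetrize (x : X → ℝ) : symmetrize G (symmetrize G x) = symmetrize G x :=
  symmetrize_of_invariant G fun _ hσ j => symmetrize_perm G x hσ j

theorem sum_symmetrize_mul {h : X → ℝ} (hh : ∀ σ ∈ G, ∀ j, h (σ j) = h j) (u : X → ℝ) :
    ∑ k, symmetrize G u k * h k = ∑ k, u k * h k := by
  classical
  simp only [symmetrize_apply, div_mul_eq_mul_div, Finset.sum_mul]
  rw [← Finset.sum_div, Finset.sum_comm]
  have : ∀ σ : G, ∑ k, u ((σ : Equiv.Perm X)⁻¹ k) * h k = ∑ k, u k * h k := fun σ =>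
    Fintype.sum_equiv (σ : Equiv.Perm X)⁻¹ _ _ fun k => by rw [hh _ (inv_mem σ.2)]
  rw [Finset.sum_congr rfl fun σ _ => this σ]
  simp

theorem sum_symmetrize (u : X → ℝ) : ∑ k, symmetrize G u k = ∑ k, u k := by
  simpa using sum_symmetrize_mul G (h := 1) (fun _ _ _ => rfl) u

theorem multilinearExt_marginal_perm {f : Finset X → ℝ}
    (hf : ∀ σ ∈ G, ∀ S : Finset X, f (S.map σ.toEmbedding) = f S) {x : X → ℝ}
    (hx : ∀ σ ∈ G, ∀ j, x (σ j) = x j) {τ : Equiv.Perm X} (hτ : τ ∈ G) (k : X) :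
    multilinearExt (marginal (τ k) f) x = multilinearExt (marginal k f) x := by
  rw [multilinearExt_eq_sum_weight, multilinearExt_eq_sum_weight]
  symm
  refine Fintype.sum_equiv (Equiv.finsetCongr τ) _ _ fun S => ?_
  rw [Equiv.finsetCongr_apply]
  congr 1
  · unfold marginal
    rw [← hf τ hτ (insert k S), ← hf τ hτ (S.erase k), Finset.map_insert, Finset.map_erase]
    rfl
  · unfold weight
    refine Fintype.prod_equiv τ _ _ fun i => ?_
    simp [hx τ hτ]

/-- The gradient at a symmetric point is G-invariant, so pairing it with u or with the average of u
over G gives the same number. This is how the invariance of f enters the estimates. -/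
theorem multilinearDeriv_symmetrize {f : Finset X → ℝ}
    (hf : ∀ σ ∈ G, ∀ S : Finset X, f (S.map σ.toEmbedding) = f S) (u x : X → ℝ) :
    multilinearDeriv f (symmetrize G u) (symmetrize G x) =
      multilinearDeriv f u (symmetrize G x) :=
  sum_symmetrize_mul G (fun _ hσ k => multilinearExt_marginal_perm G hf
    (fun _ hτ j => symmetrize_perm G x hτ j) hσ k) u

end Symmetrize

/-! ### A cutoff that is slow on a logarithmic scale -/

theorem iteratedDeriv_smoothTransition_eq_zero {n : ℕ} (hn : n ≠ 0) {s : ℝ} (hs : s ∉ Set.Icc (0 : ℝ) 1) :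
    iteratedDeriv n Real.smoothTransition s = 0 := by
  have h : ∃ c : ℝ, Real.smoothTransition =ᶠ[nhds s] fun _ => c := by
    rw [Set.mem_Icc, not_and_or, not_le, not_le] at hs
    rcases hs with hs | hs
    · exact ⟨0, (eventually_lt_nhds hs).mono fun t ht =>
        Real.smoothTransition.zero_of_nonpos ht.le⟩
    · exact ⟨1, (eventually_gt_nhds hs).mono fun t ht =>
        Real.smoothTransition.one_of_one_le ht.le⟩
  obtain ⟨c, hc⟩ := h
  rw [hc.iteratedDeriv_eq, iteratedDeriv_const, if_neg hn]

theorem exists_bound_smoothTransition_iteratedDeriv {n : ℕ} (hn : n ≠ 0) :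
    ∃ B : ℝ, 0 < B ∧ ∀ s, |iteratedDeriv n Real.smoothTransition s| ≤ B := by
  have hc : Continuous (iteratedDeriv n Real.smoothTransition) :=
    (Real.smoothTransition.contDiff (n := n)).continuous_iteratedDeriv n le_rfl
  obtain ⟨B, hB⟩ := (isCompact_Icc (a := (0 : ℝ)) (b := 1)).exists_bound_of_continuousOn
    hc.continuousOn
  refine ⟨max B 1, by positivity, fun s => ?_⟩
  by_cases hs : s ∈ Set.Icc (0 : ℝ) 1
  · exact (hB s hs).trans (le_max_left _ _)
  · rw [iteratedDeriv_smoothTransition_eq_zero hn hs, abs_zero]; positivity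

/-- A twice differentiable cutoff function `φ` that decreases from `1` to `0` so slowly that
`t φ'(t)` and `t² φ''(t)` are small. -/
theorem exists_slow_cutoff {η ρ : ℝ} (hη : 0 < η) (hρ : 0 < ρ) :
    ∃ δ : ℝ, 0 < δ ∧ ∃ φ φ₁ φ₂ : ℝ → ℝ, (∀ t, HasDerivAt φ (φ₁ t) t) ∧
      (∀ t, HasDerivAt φ₁ (φ₂ t) t) ∧ (∀ t, 0 ≤ φ t) ∧ (∀ t, φ t ≤ 1) ∧ (∀ t ≤ δ, φ t = 1) ∧
      (∀ t, ρ ≤ t → φ t = 0) ∧ (∀ t, 0 ≤ t → |φ₁ t| * t ≤ η) ∧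
      (∀ t, 0 ≤ t → |φ₂ t| * t ^ 2 ≤ η) := by
  obtain ⟨B₁, hB₁, h₁⟩ := exists_bound_smoothTransition_iteratedDeriv one_ne_zero
  obtain ⟨B₂, hB₂, h₂⟩ := exists_bound_smoothTransition_iteratedDeriv two_ne_zero
  set ψ := Real.smoothTransition with hψ
  set ψ₁ := deriv ψ with hψ₁
  set ψ₂ := deriv ψ₁ with hψ₂
  have hψcd : ContDiff ℝ 2 ψ := Real.smoothTransition.contDiff
  have hd₁ : ∀ s, HasDerivAt ψ (ψ₁ s) s := fun s =>
    (hψcd.differentiable (by norm_num) s).hasDerivAt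
  have hd₂ : ∀ s, HasDerivAt ψ₁ (ψ₂ s) s := fun s =>
    ((hψcd.iterate_deriv' 1 1).differentiable (by norm_num) s).hasDerivAt
  have hb₁ : ∀ s, |ψ₁ s| ≤ B₁ := fun s => by simpa [iteratedDeriv_one] using h₁ s
  have hb₂ : ∀ s, |ψ₂ s| ≤ B₂ := fun s => by
    simpa [iteratedDeriv_succ, iteratedDeriv_one] using h₂ s
  have hz₁ : ∀ s < 0, ψ₁ s = 0 := fun s hs => by
    have := iteratedDeriv_smoothTransition_eq_zero one_ne_zero (s := s) (fun h => absurd h.1 hs.not_ge)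
    simpa [iteratedDeriv_one] using this
  have hz₂ : ∀ s < 0, ψ₂ s = 0 := fun s hs => by
    have := iteratedDeriv_smoothTransition_eq_zero two_ne_zero (s := s) (fun h => absurd h.1 hs.not_ge)
    simpa [iteratedDeriv_succ, iteratedDeriv_one] using this
  -- The cutoff is φ(t) = 1 − ψ(a log(t/δ)). Then tφ' = −aψ' and t²φ'' = a(ψ' − aψ''), so a small
  -- slope a makes both small.
  set a : ℝ := min 1 (η / (B₁ + B₂)) with ha
  have ha0 : 0 < a := by positivity
  have ha1 : a ≤ 1 := min_le_left _ _
  have haη : a * (B₁ + B₂) ≤ η := by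
    have := min_le_right 1 (η / (B₁ + B₂))
    rwa [← ha, le_div_iff₀ (by positivity)] at this
  -- This δ solves a log(ρ/δ) = 1, so the transition takes place exactly between δ and ρ.
  set δ : ℝ := ρ * Real.exp (-(1 / a)) with hδdef
  have hδ : 0 < δ := by positivity
  set θ : ℝ → ℝ := fun t => a * Real.log (t / δ) with hθ
  have hθd : ∀ t, 0 < t → HasDerivAt θ (a / t) t := fun t ht => by
    have h := (((hasDerivAt_id t).div_const δ).log (div_pos ht hδ).ne').const_mul a
    refine h.congr_deriv ?_
    simp only [id]
    field_simp
  have hθneg : ∀ t, 0 < t → t < δ → θ t < 0 := fun t ht htδ =>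
    mul_neg_of_pos_of_neg ha0 (Real.log_neg (by positivity) ((div_lt_one hδ).2 htδ))
  have hθnp : ∀ t, 0 < t → t ≤ δ → θ t ≤ 0 := fun t ht htδ =>
    mul_nonpos_of_nonneg_of_nonpos ha0.le
      (Real.log_nonpos (by positivity) ((div_le_one hδ).2 htδ))
  -- The case distinction overrides the default values of `Real.log` at t ≤ 0. It creates no seam,
  -- since φ is constantly 1 up to δ > 0.
  set φ : ℝ → ℝ := fun t => if 0 < t then 1 - ψ (θ t) else 1 with hφ
  set φ₁ : ℝ → ℝ := fun t => if 0 < t then -(ψ₁ (θ t) * (a / t)) else 0 with hφ₁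
  set φ₂ : ℝ → ℝ := fun t =>
    if 0 < t then -(ψ₂ (θ t) * (a / t) * (a / t) + ψ₁ (θ t) * (-a / t ^ 2)) else 0 with hφ₂
  have hone : ∀ t ≤ δ, φ t = 1 := fun t ht => by
    simp only [hφ]
    split_ifs with h
    · rw [hψ, Real.smoothTransition.zero_of_nonpos (hθnp t h ht), sub_zero]
    · rfl
  have hzero₁ : ∀ t < δ, φ₁ t = 0 := fun t ht => by
    simp only [hφ₁]
    split_ifs with h
    · rw [hz₁ _ (hθneg t h ht)]; simp
    · rfl
  have hzero₂ : ∀ t < δ, φ₂ t = 0 := fun t ht => by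
    simp only [hφ₂]
    split_ifs with h
    · rw [hz₁ _ (hθneg t h ht), hz₂ _ (hθneg t h ht)]; simp
    · rfl
  refine ⟨δ, hδ, φ, φ₁, φ₂, fun t => ?_, fun t => ?_, fun t => ?_, fun t => ?_, hone,
    fun t ht => ?_, fun t ht => ?_, fun t ht => ?_⟩
  · rcases lt_or_ge t δ with h | h
    · rw [hzero₁ t h]
      exact (hasDerivAt_const t 1).congr_of_eventuallyEq
        ((eventually_lt_nhds h).mono fun s hs => hone s hs.le)
    · have ht : 0 < t := hδ.trans_le h
      have := ((hd₁ (θ t)).comp t (hθd t ht)).const_sub 1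
      simp only [hφ₁, ht, if_true]
      exact this.congr_of_eventuallyEq
        ((eventually_gt_nhds ht).mono fun s hs => by simp [hφ, hs])
  · rcases lt_or_ge t δ with h | h
    · rw [hzero₂ t h]
      exact (hasDerivAt_const t 0).congr_of_eventuallyEq
        ((eventually_lt_nhds h).mono fun s hs => hzero₁ s hs)
    · have ht : 0 < t := hδ.trans_le h
      have hinv : HasDerivAt (fun s : ℝ => a / s) (-a / t ^ 2) t := by
        simpa [div_eq_mul_inv] using (hasDerivAt_inv ht.ne').const_mul a
      have := (((hd₂ (θ t)).comp t (hθd t ht)).mul hinv).neg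
      simp only [hφ₂, ht, if_true]
      exact this.congr_of_eventuallyEq
        ((eventually_gt_nhds ht).mono fun s hs => by simp [hφ₁, hs])
  · simp only [hφ]
    split_ifs
    · exact sub_nonneg.2 (Real.smoothTransition.le_one _)
    · exact zero_le_one
  · simp only [hφ]
    split_ifs
    · exact sub_le_self _ (Real.smoothTransition.nonneg _)
    · exact le_rfl
  · have ht0 : 0 < t := hρ.trans_le ht
    have : 1 ≤ θ t := by
      have h1 : 1 / a ≤ Real.log (t / δ) := by
        rw [Real.le_log_iff_exp_le (by positivity), le_div_iff₀ hδ, hδdef, mul_left_comm,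
          ← Real.exp_add]
        simpa using ht
      calc (1 : ℝ) = a * (1 / a) := by field_simp
        _ ≤ θ t := mul_le_mul_of_nonneg_left h1 ha0.le
    simp only [hφ, ht0, if_true]
    rw [hψ, Real.smoothTransition.one_of_one_le this, sub_self]
  · rcases ht.eq_or_lt with rfl | ht
    · simpa using hη.le
    simp only [hφ₁, ht, if_true]
    rw [abs_neg, abs_mul, abs_of_pos (div_pos ha0 ht), mul_assoc, div_mul_cancel₀ _ ht.ne']
    nlinarith [hb₁ (θ t), abs_nonneg (ψ₁ (θ t))]
  · rcases ht.eq_or_lt with rfl | ht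
    · simpa using hη.le
    simp only [hφ₂, ht, if_true]
    have : -(ψ₂ (θ t) * (a / t) * (a / t) + ψ₁ (θ t) * (-a / t ^ 2)) * t ^ 2 =
        a * (ψ₁ (θ t) - a * ψ₂ (θ t)) := by field_simp; ring
    rw [← abs_of_pos (pow_pos ht 2), ← abs_mul, abs_of_pos (pow_pos ht 2), this, abs_mul,
      abs_of_pos ha0]
    refine le_trans (mul_le_mul_of_nonneg_left ?_ ha0.le) haη
    refine (abs_sub _ _).trans (add_le_add (hb₁ _) ?_)
    rw [abs_mul, abs_of_pos ha0]
    nlinarith [hb₂ (θ t), abs_nonneg (ψ₂ (θ t))]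

/-! ### Distance from the symmetrization -/

section Asymmetry

variable {X : Type*} [Fintype X] [DecidableEq X] (G : Subgroup (Equiv.Perm X))

/-- The `ℓ¹`-distance of `x` from its symmetrization. -/
noncomputable def asymmetry (x : X → ℝ) : ℝ := ∑ i, |x i - symmetrize G x i|

/-- The squared `ℓ²`-distance of `x` from its symmetrization. -/
noncomputable def sqAsymmetry (x : X → ℝ) : ℝ := ∑ i, (x i - symmetrize G x i) ^ 2

/-- The polarization of `sqAsymmetry`. -/
noncomputable def asymmetryForm (u v : X → ℝ) : ℝ :=
  ∑ i, (u i - symmetrize G u i) * (v i - symmetrize G v i)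

theorem asymmetry_nonneg (x : X → ℝ) : 0 ≤ asymmetry G x :=
  Finset.sum_nonneg fun _ _ => abs_nonneg _

theorem sqAsymmetry_nonneg (x : X → ℝ) : 0 ≤ sqAsymmetry G x :=
  Finset.sum_nonneg fun _ _ => sq_nonneg _

theorem sq_asymmetry_le (x : X → ℝ) :
    asymmetry G x ^ 2 ≤ Fintype.card X * sqAsymmetry G x := by
  have := sq_sum_le_card_mul_sum_sq (s := (Finset.univ : Finset X))
    (f := fun i => |x i - symmetrize G x i|)
  simpa [asymmetry, sqAsymmetry] using this

theorem abs_asymmetryForm_le (u v : X → ℝ) :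
    |asymmetryForm G u v| ≤ asymmetry G u * asymmetry G v := by
  unfold asymmetryForm asymmetry
  refine (Finset.abs_sum_le_sum_abs _ _).trans ?_
  rw [Finset.sum_mul]
  refine Finset.sum_le_sum fun i _ => ?_
  rw [abs_mul]
  exact mul_le_mul_of_nonneg_left (Finset.single_le_sum
    (f := fun i => |v i - symmetrize G v i|) (fun _ _ => abs_nonneg _) (Finset.mem_univ i))
    (abs_nonneg _)

theorem asymmetry_le_two_mul_sum {u : X → ℝ} (hu : 0 ≤ u) : asymmetry G u ≤ 2 * ∑ i, u i := by
  have h : asymmetry G u ≤ ∑ i, (u i + symmetrize G u i) := Finset.sum_le_sum fun i _ => by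
    have h1 := hu i
    have h2 := symmetrize_nonneg G hu i
    simp only [Pi.zero_apply] at h1 h2
    rw [abs_le]; constructor <;> linarith
  rw [Finset.sum_add_distrib, sum_symmetrize] at h
  linarith

theorem asymmetry_le_card {x : X → ℝ} (h0 : 0 ≤ x) (h1 : x ≤ 1) :
    asymmetry G x ≤ Fintype.card X := by
  have : asymmetry G x ≤ ∑ _i : X, 1 := Finset.sum_le_sum fun i _ => by
    have a := h0 i
    have b := h1 i
    have c := symmetrize_nonneg G h0 i
    have d := symmetrize_le_one G h1 i
    simp only [Pi.zero_apply, Pi.one_apply] at a b c d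
    rw [abs_le]; constructor <;> linarith
  simpa using this

theorem hasLineDerivAt_comp_symmetrize {A A' : (X → ℝ) → ℝ} {u : X → ℝ}
    (h : ∀ y, HasLineDerivAt ℝ A (A' y) y (symmetrize G u)) (x : X → ℝ) :
    HasLineDerivAt ℝ (fun y => A (symmetrize G y)) (A' (symmetrize G x)) x u := by
  have := h (symmetrize G x)
  unfold HasLineDerivAt at this ⊢
  simpa only [symmetrize_add, symmetrize_smul] using this

theorem hasLineDerivAt_asymmetryForm_left (x u v : X → ℝ) :
    HasLineDerivAt ℝ (fun y => asymmetryForm G y v) (asymmetryForm G u v) x u := by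
  unfold HasLineDerivAt asymmetryForm
  refine HasDerivAt.fun_sum fun i _ => HasDerivAt.mul_const ?_ _
  have : HasDerivAt (fun t : ℝ => x i - symmetrize G x i + t * (u i - symmetrize G u i))
      (u i - symmetrize G u i) 0 := by
    simpa using ((hasDerivAt_id (0 : ℝ)).mul_const (u i - symmetrize G u i)).const_add
      (x i - symmetrize G x i)
  refine this.congr_of_eventuallyEq (Filter.Eventually.of_forall fun t => ?_)
  simp only [symmetrize_add, symmetrize_smul, Pi.add_apply, Pi.smul_apply, smul_eq_mul]
  ring

theorem hasLineDerivAt_sqAsymmetry (x u : X → ℝ) :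
    HasLineDerivAt ℝ (sqAsymmetry G) (2 * asymmetryForm G x u) x u := by
  have h1 : ∀ t : ℝ, sqAsymmetry G (x + t • u) =
      sqAsymmetry G x + t * (2 * asymmetryForm G x u) + t ^ 2 * sqAsymmetry G u := fun t => by
    unfold sqAsymmetry asymmetryForm
    simp only [symmetrize_add, symmetrize_smul, Pi.add_apply, Pi.smul_apply, smul_eq_mul,
      Finset.mul_sum, ← Finset.sum_add_distrib]
    exact Finset.sum_congr rfl fun i _ => by ring
  unfold HasLineDerivAt
  simp only [h1]
  have h2 := (((hasDerivAt_id (0 : ℝ)).mul_const (2 * asymmetryForm G x u)).const_add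
    (sqAsymmetry G x)).add (((hasDerivAt_id (0 : ℝ)).pow 2).mul_const (sqAsymmetry G u))
  refine h2.congr_deriv ?_
  simp

end Asymmetry

/-! ### The correction term -/

section Correction

variable {X : Type*} [Fintype X]

/-- A nonnegative strictly increasing function with strictly negative mixed second
derivatives. -/
noncomputable def correction (x : X → ℝ) : ℝ :=
  (2 * Fintype.card X + 1) * (∑ i, x i) - (∑ i, x i) ^ 2

theorem hasLineDerivAt_sum (x u : X → ℝ) :
    HasLineDerivAt ℝ (fun y : X → ℝ => ∑ i, y i) (∑ i, u i) x u := by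
  unfold HasLineDerivAt
  simp only [Pi.add_apply, Pi.smul_apply, smul_eq_mul, Finset.sum_add_distrib, ← Finset.mul_sum]
  simpa using ((hasDerivAt_id (0 : ℝ)).mul_const (∑ i, u i)).const_add (∑ i, x i)

theorem hasLineDerivAt_correction (x u : X → ℝ) :
    HasLineDerivAt ℝ correction ((2 * Fintype.card X + 1 - 2 * ∑ i, x i) * ∑ i, u i) x u := by
  have h := hasLineDerivAt_sum x u
  unfold HasLineDerivAt at h
  have := (h.const_mul (2 * (Fintype.card X : ℝ) + 1)).sub (h.pow 2)
  refine this.congr_deriv ?_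
  simp
  ring

theorem hasLineDerivAt_correction_deriv (x u v : X → ℝ) :
    HasLineDerivAt ℝ (fun y : X → ℝ => (2 * Fintype.card X + 1 - 2 * ∑ i, y i) * ∑ i, u i)
      (-2 * (∑ i, u i) * ∑ i, v i) x v := by
  have h := hasLineDerivAt_sum x v
  unfold HasLineDerivAt at h
  have := ((h.const_mul 2).const_sub (2 * (Fintype.card X : ℝ) + 1)).mul_const (∑ i, u i)
  refine this.congr_deriv ?_
  ring

theorem sum_nonneg_of_nonneg {x : X → ℝ} (h0 : 0 ≤ x) : 0 ≤ ∑ i, x i :=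
  Finset.sum_nonneg fun i _ => h0 i

theorem sum_le_card_of_le_one {x : X → ℝ} (h1 : x ≤ 1) : ∑ i, x i ≤ Fintype.card X := by
  have : ∑ i, x i ≤ ∑ _i : X, (1 : ℝ) := Finset.sum_le_sum fun i _ => h1 i
  simpa using this

theorem correction_nonneg {x : X → ℝ} (h0 : 0 ≤ x) (h1 : x ≤ 1) : 0 ≤ correction x := by
  have a := sum_nonneg_of_nonneg h0
  have b := sum_le_card_of_le_one h1
  unfold correction
  nlinarith

theorem correction_le {x : X → ℝ} (h0 : 0 ≤ x) (h1 : x ≤ 1) :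
    correction x ≤ (2 * Fintype.card X + 1) * Fintype.card X := by
  have a := sum_nonneg_of_nonneg h0
  have b := sum_le_card_of_le_one h1
  unfold correction
  nlinarith [sq_nonneg (∑ i, x i)]

end Correction

/-! ### Closeness to the symmetrized extension -/

section Perturbation

variable {X : Type*} [Fintype X] [DecidableEq X] {G : Subgroup (Equiv.Perm X)}
  {f : Finset X → ℝ}

/-- By `multilinearDeriv_symmetrize` both derivatives may be taken in the direction u. Their base
points are `asymmetry G x` apart in ℓ¹, and the second derivatives are controlled by M. -/
theorem abs_multilinearDeriv_sub_le (hinv : ∀ σ ∈ G, ∀ S : Finset X, f (S.map σ.toEmbedding) = f S)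
    {M : ℝ} (hM : ∀ k l S, |marginal l (marginal k f) S| ≤ M) (u : X → ℝ) {x : X → ℝ}
    (h0 : 0 ≤ x) (h1 : x ≤ 1) :
    |multilinearDeriv f u x - multilinearDeriv f (symmetrize G u) (symmetrize G x)| ≤
      M * (∑ i, |u i|) * asymmetry G x := by
  rw [multilinearDeriv_symmetrize G hinv]
  have h := abs_sub_le_of_hasLineDerivAt (A := multilinearDeriv f u) (u := x - symmetrize G x)
    (fun y => hasLineDerivAt_multilinearDeriv f u _ y) (symmetrize G x)
    (C := M * (∑ i, |u i|) * asymmetry G x) (fun s hs => by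
      have hmem := (convex_Icc (0 : X → ℝ) 1).add_smul_sub_mem
        ⟨symmetrize_nonneg G h0, symmetrize_le_one G h1⟩ ⟨h0, h1⟩ hs
      exact abs_multilinearDeriv₂_le hM u _ hmem.1 hmem.2)
  rwa [add_sub_cancel] at h

/-- The bound is quadratic because the direction x − x̄ has symmetrization zero: the derivative
along the segment from x̄ to x vanishes at x̄, and so stays linear in the asymmetry. -/
theorem abs_multilinearExt_sub_le (hinv : ∀ σ ∈ G, ∀ S : Finset X, f (S.map σ.toEmbedding) = f S)
    {M : ℝ} (hM : ∀ k l S, |marginal l (marginal k f) S| ≤ M) (hM0 : 0 ≤ M) {x : X → ℝ}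
    (h0 : 0 ≤ x) (h1 : x ≤ 1) :
    |multilinearExt f x - multilinearExt f (symmetrize G x)| ≤ M * asymmetry G x ^ 2 := by
  set y := symmetrize G x with hy
  have hz : symmetrize G (x - y) = 0 := by
    rw [sub_eq_add_neg, ← neg_one_smul ℝ y, symmetrize_add, symmetrize_smul, hy,
      symmetrize_symmetrize]
    simp
  have h := abs_sub_le_of_hasLineDerivAt (A := multilinearExt f) (u := x - y)
    (fun w => hasLineDerivAt_multilinearExt f _ w) y
    (C := M * asymmetry G x ^ 2) (fun s hs => by
      have hmem := (convex_Icc (0 : X → ℝ) 1).add_smul_sub_mem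
        ⟨symmetrize_nonneg G h0, symmetrize_le_one G h1⟩ ⟨h0, h1⟩ hs
      have hb := abs_multilinearDeriv_sub_le hinv hM (x - y) hmem.1 hmem.2
      have hzero : multilinearDeriv f (0 : X → ℝ) = 0 := by
        ext w; simp [multilinearDeriv]
      have ha : asymmetry G (y + s • (x - y)) ≤ asymmetry G x := by
        unfold asymmetry
        refine Finset.sum_le_sum fun i _ => ?_
        rw [symmetrize_add, symmetrize_smul, hz, hy, symmetrize_symmetrize, ← hy]
        simp only [Pi.add_apply, Pi.smul_apply, Pi.sub_apply, smul_eq_mul, Pi.zero_apply, mul_zero,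
          add_zero, add_sub_cancel_left, abs_mul, abs_of_nonneg hs.1]
        exact mul_le_of_le_one_left (abs_nonneg _) hs.2
      rw [hz, hzero] at hb
      simp only [Pi.zero_apply, sub_zero] at hb
      refine hb.trans ?_
      have hs' : ∑ i, |(x - y) i| = asymmetry G x := rfl
      rw [hs', pow_two, ← mul_assoc]
      exact mul_le_mul_of_nonneg_left ha (mul_nonneg hM0 (asymmetry_nonneg G x)))
  rwa [add_sub_cancel] at h

end Perturbation

/-! ### Derivatives of the interpolating function -/

section Interpolation

variable {V : Type*} [AddCommGroup V] [Module ℝ V]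

theorem hasLineDerivAt_scalar_comp {φ : ℝ → ℝ} {D : V → ℝ} {c d : ℝ} {x u : V}
    (hφ : HasDerivAt φ c (D x)) (hD : HasLineDerivAt ℝ D d x u) :
    HasLineDerivAt ℝ (fun y => φ (D y)) (c * d) x u := by
  refine HasDerivAt.comp (h₂ := φ) (h := fun t : ℝ => D (x + t • u)) (0 : ℝ) ?_ hD
  simpa using hφ

theorem hasLineDerivAt_interpolation {A B D J : V → ℝ} {φ φ₁ : ℝ → ℝ} {κ a b d j : ℝ} {x u : V}
    (hφ : ∀ t, HasDerivAt φ (φ₁ t) t) (hA : HasLineDerivAt ℝ A a x u)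
    (hB : HasLineDerivAt ℝ B b x u) (hD : HasLineDerivAt ℝ D d x u)
    (hJ : HasLineDerivAt ℝ J j x u) :
    HasLineDerivAt ℝ (fun y => A y - φ (D y) * (A y - B y) + κ * J y)
      (a - (φ₁ (D x) * d * (A x - B x) + φ (D x) * (a - b)) + κ * j) x u := by
  have hφD : HasDerivAt (fun t : ℝ => φ (D (x + t • u))) (φ₁ (D x) * d) 0 :=
    hasLineDerivAt_scalar_comp (hφ _) hD
  have := (HasDerivAt.sub hA (hφD.mul (HasDerivAt.sub hA hB))).add (HasDerivAt.const_mul κ hJ)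
  refine this.congr_deriv ?_
  simp

/-- The value is arranged for sign control: for 0 ≤ φ ≤ 1 the second derivatives of A and B enter as
a convex combination, the four terms with φ₁ or φ₂ are errors, and the J-term has to outweigh them.
-/
theorem hasLineDerivAt_interpolation_deriv {A B D A₁ B₁ D₁ J₁ : V → ℝ} {φ φ₁ φ₂ : ℝ → ℝ}
    {κ av bv dv a₂ b₂ d₂ j₂ : ℝ} {x v : V}
    (hφ : ∀ t, HasDerivAt φ (φ₁ t) t) (hφ₁ : ∀ t, HasDerivAt φ₁ (φ₂ t) t)
    (hA : HasLineDerivAt ℝ A av x v) (hB : HasLineDerivAt ℝ B bv x v)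
    (hD : HasLineDerivAt ℝ D dv x v) (hA₁ : HasLineDerivAt ℝ A₁ a₂ x v)
    (hB₁ : HasLineDerivAt ℝ B₁ b₂ x v) (hD₁ : HasLineDerivAt ℝ D₁ d₂ x v)
    (hJ₁ : HasLineDerivAt ℝ J₁ j₂ x v) :
    HasLineDerivAt ℝ (fun y => A₁ y - (φ₁ (D y) * D₁ y * (A y - B y) +
        φ (D y) * (A₁ y - B₁ y)) + κ * J₁ y)
      ((1 - φ (D x)) * a₂ + φ (D x) * b₂ - (φ₂ (D x) * dv * D₁ x * (A x - B x) +
        φ₁ (D x) * d₂ * (A x - B x) + φ₁ (D x) * D₁ x * (av - bv) +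
        φ₁ (D x) * dv * (A₁ x - B₁ x)) + κ * j₂) x v := by
  have hφD : HasDerivAt (fun t : ℝ => φ (D (x + t • v))) (φ₁ (D x) * dv) 0 :=
    hasLineDerivAt_scalar_comp (hφ _) hD
  have hφD₁ : HasDerivAt (fun t : ℝ => φ₁ (D (x + t • v))) (φ₂ (D x) * dv) 0 :=
    hasLineDerivAt_scalar_comp (hφ₁ _) hD
  have := (HasDerivAt.sub hA₁ (((hφD₁.mul hD₁).mul (HasDerivAt.sub hA hB)).add
    (hφD.mul (HasDerivAt.sub hA₁ hB₁)))).add (HasDerivAt.const_mul κ hJ₁)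
  refine this.congr_deriv ?_
  simp
  ring

end Interpolation

/-! ### The symmetric perturbation -/

section Perturbation

variable {X : Type*} [Fintype X] [DecidableEq X] {G : Subgroup (Equiv.Perm X)}
  {f : Finset X → ℝ}

theorem exists_marginal_bound (f : Finset X → ℝ) :
    ∃ M : ℝ, 0 ≤ M ∧ ∀ k l S, |marginal l (marginal k f) S| ≤ M :=
  ⟨∑ k, ∑ l, ∑ S, |marginal l (marginal k f) S|, by positivity, fun k l S =>
    (Finset.single_le_sum (f := fun S => |marginal l (marginal k f) S|)
      (fun _ _ => abs_nonneg _) (Finset.mem_univ S)).trans <|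
    (Finset.single_le_sum (f := fun l => ∑ S, |marginal l (marginal k f) S|)
      (fun _ _ => by positivity) (Finset.mem_univ l)).trans <|
    (Finset.single_le_sum (f := fun k => ∑ l, ∑ S, |marginal l (marginal k f) S|)
      (fun _ _ => by positivity) (Finset.mem_univ k))⟩

set_option maxHeartbeats 1000000 in
/-- The multilinear extension of an invariant submodular function can be perturbed slightly, such
that close to its symmetrization `x` becomes indistinguishable from it, while diminishing returns
and monotonicity are preserved. -/
theorem exists_symmetric_perturbation {mono : Prop} (hf : IsObjective mono f)
    (hinv : ∀ σ ∈ G, ∀ S : Finset X, f (S.map σ.toEmbedding) = f S) {η : ℝ} (hη : 0 < η) :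
    ∃ δ : ℝ, 0 < δ ∧ ∃ Φ : (X → ℝ) → ℝ,
      (∀ x, 0 ≤ x → x ≤ 1 → 0 ≤ Φ x) ∧
      (∀ x, 0 ≤ x → x ≤ 1 → |Φ x - multilinearExt f x| ≤ η) ∧
      (∀ x u v, 0 ≤ x → 0 ≤ u → 0 ≤ v → x + u + v ≤ 1 →
        Φ (x + u + v) + Φ x ≤ Φ (x + u) + Φ (x + v)) ∧
      (mono → ∀ x u, 0 ≤ x → 0 ≤ u → x + u ≤ 1 → Φ x ≤ Φ (x + u)) ∧
      (∀ x, sqAsymmetry G x ≤ δ → Φ x = Φ (symmetrize G x)) := by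
  obtain ⟨hnn, hsub, hmono⟩ := hf
  obtain ⟨M, hM0, hM⟩ := exists_marginal_bound f
  set m : ℝ := (Fintype.card X : ℝ) with hm
  have hm0 : 0 ≤ m := Nat.cast_nonneg _
  -- The tolerance η is split in halves. K η' is κ times the upper bound of `correction`, and M m ρ
  -- bounds the cutoff term where φ does not vanish.
  set K : ℝ := 32 * M * (m + 1) ^ 2 * ((2 * m + 1) * m) with hK
  have hK0 : 0 ≤ K := by positivity
  set η' : ℝ := η / (2 * (K + 1)) with hη'
  have hη'0 : 0 < η' := by positivity
  set ρ : ℝ := η / (2 * (M * m + 1)) with hρ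
  have hρ0 : 0 < ρ := by positivity
  have hKη : K * η' ≤ η / 2 := by
    rw [hη', mul_div_assoc', div_le_div_iff₀ (by positivity) (by norm_num)]
    nlinarith
  have hMρ : M * m * ρ ≤ η / 2 := by
    rw [hρ, mul_div_assoc', div_le_div_iff₀ (by positivity) (by norm_num)]
    nlinarith
  -- Large enough for κJ to outweigh the error terms in both the mixed second derivative and the
  -- first derivative, yet proportional to η'.
  set κ : ℝ := 32 * M * (m + 1) ^ 2 * η' with hκ
  have hκ0 : 0 ≤ κ := by positivity
  obtain ⟨δ, hδ, φ, φ₁, φ₂, hφ, hφ₁, hφ0, hφle, hφδ, hφρ, hφ₁b, hφ₂b⟩ :=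
    exists_slow_cutoff hη'0 hρ0
  set A : (X → ℝ) → ℝ := multilinearExt f with hA
  set B : (X → ℝ) → ℝ := fun y => multilinearExt f (symmetrize G y) with hB
  set Φ : (X → ℝ) → ℝ := fun y =>
    A y - φ (sqAsymmetry G y) * (A y - B y) + κ * correction y with hΦ
  have hA' : ∀ u x, HasLineDerivAt ℝ A (multilinearDeriv f u x) x u :=
    hasLineDerivAt_multilinearExt f
  have hB' : ∀ u x, HasLineDerivAt ℝ B
      (multilinearDeriv f (symmetrize G u) (symmetrize G x)) x u := fun u x =>
    hasLineDerivAt_comp_symmetrize G (hasLineDerivAt_multilinearExt f _) x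
  have hB'' : ∀ u v x, HasLineDerivAt ℝ
      (fun y => multilinearDeriv f (symmetrize G u) (symmetrize G y))
      (multilinearDeriv₂ f (symmetrize G u) (symmetrize G v) (symmetrize G x)) x v :=
    fun u v x => hasLineDerivAt_comp_symmetrize G (hasLineDerivAt_multilinearDeriv f _ _) x
  have hD := hasLineDerivAt_sqAsymmetry G
  have hD' : ∀ u v x, HasLineDerivAt ℝ (fun y => 2 * asymmetryForm G y u)
      (2 * asymmetryForm G v u) x v := fun u v x =>
    HasDerivAt.const_mul 2 (hasLineDerivAt_asymmetryForm_left G x v u)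
  have hH : ∀ x, 0 ≤ x → x ≤ 1 → |A x - B x| ≤ M * asymmetry G x ^ 2 := fun x h0 h1 =>
    abs_multilinearExt_sub_le hinv hM hM0 h0 h1
  -- By Cauchy–Schwarz the slow decrease of φ pays for two powers of the asymmetry next to φ₁ and
  -- for four next to φ₂.
  have e1 : ∀ x, |φ₁ (sqAsymmetry G x)| * asymmetry G x ^ 2 ≤ m * η' := fun x => by
    calc _ ≤ |φ₁ (sqAsymmetry G x)| * (m * sqAsymmetry G x) :=
          mul_le_mul_of_nonneg_left (sq_asymmetry_le G x) (abs_nonneg _)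
      _ = m * (|φ₁ (sqAsymmetry G x)| * sqAsymmetry G x) := by ring
      _ ≤ _ := mul_le_mul_of_nonneg_left (hφ₁b _ (sqAsymmetry_nonneg G x)) hm0
  have e2 : ∀ x, |φ₂ (sqAsymmetry G x)| * asymmetry G x ^ 4 ≤ m ^ 2 * η' := fun x => by
    calc _ = |φ₂ (sqAsymmetry G x)| * (asymmetry G x ^ 2) ^ 2 := by ring
      _ ≤ |φ₂ (sqAsymmetry G x)| * (m * sqAsymmetry G x) ^ 2 := by
          gcongr; exact sq_asymmetry_le G x
      _ = m ^ 2 * (|φ₂ (sqAsymmetry G x)| * sqAsymmetry G x ^ 2) := by ring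
      _ ≤ _ := mul_le_mul_of_nonneg_left (hφ₂b _ (sqAsymmetry_nonneg G x)) (by positivity)
  have hdu : ∀ x u, 0 ≤ u → |2 * asymmetryForm G x u| ≤ 4 * asymmetry G x * ∑ i, u i :=
    fun x u hu => by
      rw [abs_mul, abs_two]
      have h1 := abs_asymmetryForm_le G x u
      have h2 := mul_le_mul_of_nonneg_left (asymmetry_le_two_mul_sum G hu) (asymmetry_nonneg G x)
      linarith
  have habs : ∀ u : X → ℝ, 0 ≤ u → ∑ i, |u i| = ∑ i, u i := fun u hu =>
    Finset.sum_congr rfl fun i _ => abs_of_nonneg (hu i)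
  refine ⟨δ, hδ, Φ, fun x h0 h1 => ?_, fun x h0 h1 => ?_, fun x u v h0 hu hv h1 => ?_,
    fun hmo x u h0 hu h1 => ?_, fun x hx => ?_⟩
  · have a := multilinearExt_nonneg hnn h0 h1
    have b := multilinearExt_nonneg hnn (symmetrize_nonneg G h0) (symmetrize_le_one G h1)
    have c := mul_nonneg hκ0 (correction_nonneg h0 h1)
    have d := mul_nonneg (hφ0 (sqAsymmetry G x)) b
    have e := mul_nonneg (sub_nonneg.2 (hφle (sqAsymmetry G x))) a
    simp only [hΦ, hA, hB]
    linarith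
  · have h2 : |φ (sqAsymmetry G x) * (A x - B x)| ≤ η / 2 := by
      rcases le_or_gt ρ (sqAsymmetry G x) with h | h
      · rw [hφρ _ h, zero_mul, abs_zero]; positivity
      · rw [abs_mul, abs_of_nonneg (hφ0 _)]
        calc _ ≤ 1 * (M * asymmetry G x ^ 2) :=
              mul_le_mul (hφle _) (hH x h0 h1) (abs_nonneg _) zero_le_one
          _ ≤ M * (m * ρ) := by
              rw [one_mul]
              gcongr
              exact (sq_asymmetry_le G x).trans (by gcongr)
          _ ≤ η / 2 := by linarith
    have h3 : κ * correction x ≤ η / 2 := by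
      calc _ ≤ κ * ((2 * m + 1) * m) := mul_le_mul_of_nonneg_left (correction_le h0 h1) hκ0
        _ = K * η' := by rw [hκ, hK]; ring
        _ ≤ _ := hKη
    have h4 := mul_nonneg hκ0 (correction_nonneg h0 h1)
    have h5 := abs_le.1 h2
    simp only [hΦ]
    rw [abs_le]
    constructor <;> linarith
  · refine diminishing_returns_of_mixed_deriv_nonpos
      (fun y => hasLineDerivAt_interpolation hφ (hA' u y) (hB' u y) (hD y u)
        (hasLineDerivAt_correction y u))
      (fun y => hasLineDerivAt_interpolation_deriv hφ hφ₁ (hA' v y) (hB' v y) (hD y v)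
        (hasLineDerivAt_multilinearDeriv f u v y) (hB'' u v y) (hD' u v y)
        (hasLineDerivAt_correction_deriv y u v)) x ?_
    intro s hs t ht
    have hy0 : 0 ≤ x + s • u + t • v :=
      add_nonneg (add_nonneg h0 (smul_nonneg hs.1 hu)) (smul_nonneg ht.1 hv)
    have hy1 : x + s • u + t • v ≤ 1 := by
      refine le_trans ?_ h1
      gcongr
      · exact smul_le_of_le_one_left hu hs.2
      · exact smul_le_of_le_one_left hv ht.2
    generalize x + s • u + t • v = y at hy0 hy1
    have n1 := multilinearDeriv₂_nonpos hsub hu hv hy0 hy1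
    have n2 := multilinearDeriv₂_nonpos hsub (symmetrize_nonneg G hu) (symmetrize_nonneg G hv)
      (symmetrize_nonneg G hy0) (symmetrize_le_one G hy1)
    have p1 := mul_nonpos_of_nonneg_of_nonpos (sub_nonneg.2 (hφle (sqAsymmetry G y))) n1
    have p2 := mul_nonpos_of_nonneg_of_nonpos (hφ0 (sqAsymmetry G y)) n2
    set a := asymmetry G y with ha
    have ha0 : 0 ≤ a := asymmetry_nonneg G y
    set su := ∑ i, u i with hsu
    set sv := ∑ i, v i with hsv
    have hsu0 : 0 ≤ su := sum_nonneg_of_nonneg hu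
    have hsv0 : 0 ≤ sv := sum_nonneg_of_nonneg hv
    have bu := hdu y u hu
    have bv := hdu y v hv
    have bH := hH y hy0 hy1
    have bHu := abs_multilinearDeriv_sub_le hinv hM u hy0 hy1
    have bHv := abs_multilinearDeriv_sub_le hinv hM v hy0 hy1
    rw [habs u hu] at bHu
    rw [habs v hv] at bHv
    have buv : |2 * asymmetryForm G v u| ≤ 8 * sv * su := by
      refine (hdu v u hu).trans ?_
      have := mul_le_mul_of_nonneg_right (asymmetry_le_two_mul_sum G hv) hsu0
      linarith
    -- Powers of the asymmetry a: each first derivative of D gives one, A − B gives two, and a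
    -- difference of first derivatives of A and B gives one. So the φ₂-term carries a⁴ and each
    -- φ₁-term carries a².
    have t1 : |φ₂ (sqAsymmetry G y) * (2 * asymmetryForm G y v) * (2 * asymmetryForm G y u) *
        (A y - B y)| ≤ 16 * M * su * sv * (m ^ 2 * η') := by
      rw [abs_mul, abs_mul, abs_mul]
      calc _ ≤ |φ₂ (sqAsymmetry G y)| * (4 * a * sv) * (4 * a * su) * (M * a ^ 2) := by gcongr
        _ = 16 * M * su * sv * (|φ₂ (sqAsymmetry G y)| * a ^ 4) := by ring
        _ ≤ _ := mul_le_mul_of_nonneg_left (e2 y) (by positivity)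
    have t2 : |φ₁ (sqAsymmetry G y) * (2 * asymmetryForm G v u) * (A y - B y)| ≤
        8 * M * su * sv * (m * η') := by
      rw [abs_mul, abs_mul]
      calc _ ≤ |φ₁ (sqAsymmetry G y)| * (8 * sv * su) * (M * a ^ 2) := by gcongr
        _ = 8 * M * su * sv * (|φ₁ (sqAsymmetry G y)| * a ^ 2) := by ring
        _ ≤ _ := mul_le_mul_of_nonneg_left (e1 y) (by positivity)
    have t3 : |φ₁ (sqAsymmetry G y) * (2 * asymmetryForm G y u) * (multilinearDeriv f v y -
        multilinearDeriv f (symmetrize G v) (symmetrize G y))| ≤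
        4 * M * su * sv * (m * η') := by
      rw [abs_mul, abs_mul]
      calc _ ≤ |φ₁ (sqAsymmetry G y)| * (4 * a * su) * (M * sv * a) := by gcongr
        _ = 4 * M * su * sv * (|φ₁ (sqAsymmetry G y)| * a ^ 2) := by ring
        _ ≤ _ := mul_le_mul_of_nonneg_left (e1 y) (by positivity)
    have t4 : |φ₁ (sqAsymmetry G y) * (2 * asymmetryForm G y v) * (multilinearDeriv f u y -
        multilinearDeriv f (symmetrize G u) (symmetrize G y))| ≤
        4 * M * su * sv * (m * η') := by
      rw [abs_mul, abs_mul]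
      calc _ ≤ |φ₁ (sqAsymmetry G y)| * (4 * a * sv) * (M * su * a) := by gcongr
        _ = 4 * M * su * sv * (|φ₁ (sqAsymmetry G y)| * a ^ 2) := by ring
        _ ≤ _ := mul_le_mul_of_nonneg_left (e1 y) (by positivity)
    -- The four errors add up to the coefficient 16m² + (8 + 4 + 4)m, which the mixed derivative −2κ
    -- · su · sv of the correction term dominates.
    have t5 : M * su * sv * η' * (16 * m ^ 2 + 16 * m) ≤ M * su * sv * η' * (64 * (m + 1) ^ 2) :=
      mul_le_mul_of_nonneg_left (by nlinarith) (by positivity)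
    have t6 : κ * (-2 * su * sv) = - (M * su * sv * η' * (64 * (m + 1) ^ 2)) := by
      rw [hκ]; ring
    have := (abs_le.1 t1).1
    have := (abs_le.1 t2).1
    have := (abs_le.1 t3).1
    have := (abs_le.1 t4).1
    linarith
  · refine le_add_of_hasLineDerivAt_nonneg
      (fun y => hasLineDerivAt_interpolation hφ (hA' u y) (hB' u y) (hD y u)
        (hasLineDerivAt_correction y u)) x ?_
    intro s hs
    have hy0 : 0 ≤ x + s • u := add_nonneg h0 (smul_nonneg hs.1 hu)
    have hy1 : x + s • u ≤ 1 := by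
      refine le_trans ?_ h1
      gcongr
      exact smul_le_of_le_one_left hu hs.2
    generalize x + s • u = y at hy0 hy1
    have n1 := multilinearDeriv_nonneg (hmono hmo) hu hy0 hy1
    have n2 := multilinearDeriv_nonneg (hmono hmo) (symmetrize_nonneg G hu)
      (symmetrize_nonneg G hy0) (symmetrize_le_one G hy1)
    have p1 := mul_nonneg (sub_nonneg.2 (hφle (sqAsymmetry G y))) n1
    have p2 := mul_nonneg (hφ0 (sqAsymmetry G y)) n2
    have ha0 : 0 ≤ asymmetry G y := asymmetry_nonneg G y
    have ham := asymmetry_le_card G hy0 hy1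
    rw [← hm] at ham
    set a := asymmetry G y with ha
    have hsu0 : 0 ≤ ∑ i, u i := sum_nonneg_of_nonneg hu
    have hyc := sum_le_card_of_le_one hy1
    rw [← hm] at hyc
    have bu := hdu y u hu
    have bH := hH y hy0 hy1
    set su := ∑ i, u i with hsu
    -- Here three powers of a are available but φ₁ needs only two; the third is bounded by m.
    have t1 : |φ₁ (sqAsymmetry G y) * (2 * asymmetryForm G y u) * (A y - B y)| ≤
        4 * M * su * m * (m * η') := by
      rw [abs_mul, abs_mul]
      calc _ ≤ |φ₁ (sqAsymmetry G y)| * (4 * m * su) * (M * a ^ 2) := by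
            gcongr
            exact bu.trans (by gcongr)
        _ = 4 * M * su * m * (|φ₁ (sqAsymmetry G y)| * a ^ 2) := by ring
        _ ≤ _ := mul_le_mul_of_nonneg_left (e1 y) (by positivity)
    have t5 : M * su * η' * (4 * m ^ 2) ≤ M * su * η' * (32 * (m + 1) ^ 2) :=
      mul_le_mul_of_nonneg_left (by nlinarith) (by positivity)
    -- On the cube the coordinate sum is at most m, so the slope factor of the correction is at
    -- least 1.
    have t6 : κ * su ≤ κ * ((2 * m + 1 - 2 * ∑ i, y i) * su) := by
      refine mul_le_mul_of_nonneg_left ?_ hκ0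
      nlinarith
    have t7 : κ * su = M * su * η' * (32 * (m + 1) ^ 2) := by rw [hκ]; ring
    have := (abs_le.1 t1).2
    linarith
  -- Where φ = 1 only B + κJ remains, and J depends on the coordinate sum alone, which
  -- symmetrization preserves.
  · have h1 : sqAsymmetry G (symmetrize G x) = 0 := by
      simp [sqAsymmetry, symmetrize_symmetrize]
    have h2 : correction (symmetrize G x) = correction x := by
      simp only [correction, sum_symmetrize]
    simp only [hΦ, hB]
    rw [h1, h2, hφδ _ hx, symmetrize_symmetrize]
    ring

end Perturbation

/-! ### Hoeffding's inequality -/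

section Concentration

/-- Hoeffding's inequality for a uniformly random function, in counting form. -/
theorem card_le_of_sum_eq_zero {N T : Type*} [Fintype N] [DecidableEq N] [Fintype T]
    (Z : N → T → ℝ) (hZ : ∀ i τ, |Z i τ| ≤ 1) (hsum : ∀ i, ∑ τ, Z i τ = 0) {t : ℝ} (ht : 0 ≤ t)
    (ht2 : t ≤ 2) :
    (Nat.card {σ : N → T // t * Fintype.card N ≤ ∑ i, Z i (σ i)} : ℝ) ≤
      (Fintype.card T : ℝ) ^ Fintype.card N * Real.exp (-(t ^ 2 / 4) * Fintype.card N) := by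
  classical
  set n := Fintype.card N with hn
  have hstep : ∀ i, ∑ τ, Real.exp (t / 2 * Z i τ) ≤ Fintype.card T * Real.exp (t ^ 2 / 4) :=
    fun i => by
      -- The bound exp y ≤ 1 + y + y² for |y| ≤ 1 needs t ≤ 2; its linear part cancels on summing
      -- over τ. With exponential parameter t/2, Markov's inequality gives the exponent t²/4 − t²/2
      -- = −t²/4 per row.
      have hb : ∀ τ, Real.exp (t / 2 * Z i τ) ≤ t / 2 * Z i τ + (1 + t ^ 2 / 4) := fun τ => by
        have habs : |t / 2 * Z i τ| ≤ t / 2 := by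
          rw [abs_mul, abs_of_nonneg (by positivity)]
          exact mul_le_of_le_one_right (by positivity) (hZ i τ)
        have h1 := (abs_le.1 (Real.abs_exp_sub_one_sub_id_le (habs.trans (by linarith)))).2
        have h2 : (t / 2 * Z i τ) ^ 2 ≤ (t / 2) ^ 2 := sq_le_sq.2 (by
          rwa [abs_of_nonneg (show 0 ≤ t / 2 by positivity)])
        nlinarith
      calc _ ≤ ∑ τ, (t / 2 * Z i τ + (1 + t ^ 2 / 4)) := Finset.sum_le_sum fun τ _ => hb τ
        _ = Fintype.card T * (1 + t ^ 2 / 4) := by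
          rw [Finset.sum_add_distrib, ← Finset.mul_sum, hsum]
          simp [mul_add]
        _ ≤ _ := by
          gcongr
          linarith [Real.add_one_le_exp (t ^ 2 / 4)]
  have htotal : ∑ σ : N → T, Real.exp (t / 2 * ∑ i, Z i (σ i)) ≤
      (Fintype.card T * Real.exp (t ^ 2 / 4)) ^ n := by
    have : ∑ σ : N → T, Real.exp (t / 2 * ∑ i, Z i (σ i)) =
        ∏ i, ∑ τ, Real.exp (t / 2 * Z i τ) := by
      rw [Finset.prod_univ_sum, Fintype.piFinset_univ]
      exact Finset.sum_congr rfl fun σ _ => by rw [Finset.mul_sum, Real.exp_sum]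
    rw [this]
    calc _ ≤ ∏ _i : N, (Fintype.card T * Real.exp (t ^ 2 / 4)) :=
          Finset.prod_le_prod (fun i _ => Finset.sum_nonneg fun _ _ => (Real.exp_pos _).le)
            fun i _ => hstep i
      _ = _ := by simp [hn]
  have hmarkov : (Nat.card {σ : N → T // t * n ≤ ∑ i, Z i (σ i)} : ℝ) *
      Real.exp (t / 2 * (t * n)) ≤ ∑ σ : N → T, Real.exp (t / 2 * ∑ i, Z i (σ i)) := by
    rw [Nat.card_eq_fintype_card, Fintype.card_subtype, ← nsmul_eq_mul, ← Finset.sum_const]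
    calc _ ≤ ∑ σ : N → T with t * n ≤ ∑ i, Z i (σ i), Real.exp (t / 2 * ∑ i, Z i (σ i)) :=
          Finset.sum_le_sum fun σ hσ => by
            have := (Finset.mem_filter.1 hσ).2
            gcongr
      _ ≤ _ := Finset.sum_le_univ_sum_of_nonneg fun _ => (Real.exp_pos _).le
  have h := hmarkov.trans htotal
  rw [← le_div_iff₀ (Real.exp_pos _)] at h
  refine h.trans_eq ?_
  rw [mul_pow, ← Real.exp_nat_mul, mul_div_assoc, ← Real.exp_sub]
  congr 2
  ring

theorem card_abs_le_of_sum_eq_zero {N T : Type*} [Fintype N] [DecidableEq N] [Fintype T]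
    (Z : N → T → ℝ) (hZ : ∀ i τ, |Z i τ| ≤ 1) (hsum : ∀ i, ∑ τ, Z i τ = 0) {t : ℝ} (ht : 0 ≤ t)
    (ht2 : t ≤ 2) :
    (Nat.card {σ : N → T // t * Fintype.card N ≤ |∑ i, Z i (σ i)|} : ℝ) ≤
      2 * ((Fintype.card T : ℝ) ^ Fintype.card N *
        Real.exp (-(t ^ 2 / 4) * Fintype.card N)) := by
  classical
  have h1 := card_le_of_sum_eq_zero Z hZ hsum ht ht2
  have h2 := card_le_of_sum_eq_zero (fun i τ => - Z i τ) (fun i τ => by rw [abs_neg]; exact hZ i τ)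
    (fun i => by rw [Finset.sum_neg_distrib, hsum, neg_zero]) ht ht2
  simp only [Nat.card_eq_fintype_card, Fintype.card_subtype, Finset.sum_neg_distrib, le_abs]
    at h1 h2 ⊢
  rw [Finset.filter_or]
  have := Finset.card_union_le
    (Finset.univ.filter fun σ : N → T => t * Fintype.card N ≤ ∑ i, Z i (σ i))
    (Finset.univ.filter fun σ : N → T => t * Fintype.card N ≤ -∑ i, Z i (σ i))
  have : ((_ : ℕ) : ℝ) ≤ _ := Nat.cast_le.2 this
  push_cast at this
  linarith

end Concentration

/-! ### Submodularity from diminishing returns -/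

section Modular

variable {X : Type*} [Fintype X] [DecidableEq X]

/-- Composing a function with diminishing returns with a nonnegative modular vector-valued set
function yields a submodular function. -/
theorem isObjective_comp_sum {E : Type*} [Fintype E] [DecidableEq E] {mono : Prop}
    {Φ : (X → ℝ) → ℝ} (hnn : ∀ x, 0 ≤ x → x ≤ 1 → 0 ≤ Φ x)
    (hdr : ∀ x u v, 0 ≤ x → 0 ≤ u → 0 ≤ v → x + u + v ≤ 1 →
      Φ (x + u + v) + Φ x ≤ Φ (x + u) + Φ (x + v))
    (hmono : mono → ∀ x u, 0 ≤ x → 0 ≤ u → x + u ≤ 1 → Φ x ≤ Φ (x + u))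
    {w : E → X → ℝ} (hw : ∀ e, 0 ≤ w e) (hw1 : ∑ e, w e ≤ 1) :
    IsObjective mono (fun S => Φ (∑ e ∈ S, w e)) := by
  have h0 : ∀ S : Finset E, 0 ≤ ∑ e ∈ S, w e := fun S => Finset.sum_nonneg fun e _ => hw e
  have h1 : ∀ S : Finset E, ∑ e ∈ S, w e ≤ 1 := fun S =>
    (Finset.sum_le_sum_of_subset_of_nonneg (Finset.subset_univ S) fun e _ _ => hw e).trans hw1
  refine ⟨fun S => hnn _ (h0 S) (h1 S), fun S T => ?_, fun hm S T hST => ?_⟩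
  · have hS : ∑ e ∈ S, w e = ∑ e ∈ S ∩ T, w e + ∑ e ∈ S \ T, w e :=
      (Finset.sum_inter_add_sum_sdiff S T w).symm
    have hT : ∑ e ∈ T, w e = ∑ e ∈ S ∩ T, w e + ∑ e ∈ T \ S, w e := by
      rw [Finset.inter_comm]; exact (Finset.sum_inter_add_sum_sdiff T S w).symm
    have hU : ∑ e ∈ S ∪ T, w e =
        ∑ e ∈ S ∩ T, w e + ∑ e ∈ S \ T, w e + ∑ e ∈ T \ S, w e := by
      rw [← hS, ← Finset.union_sdiff_self_eq_union, Finset.sum_union Finset.disjoint_sdiff]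
    have hle := h1 (S ∪ T)
    simp only
    rw [hU] at hle ⊢
    rw [hS, hT]
    exact hdr _ _ _ (h0 _) (h0 _) (h0 _) hle
  · have hT : ∑ e ∈ T, w e = ∑ e ∈ S, w e + ∑ e ∈ T \ S, w e := by
      rw [add_comm]; exact (Finset.sum_sdiff hST).symm
    have hle := h1 T
    simp only
    rw [hT] at hle ⊢
    exact hmono hm _ _ (h0 _) (h0 _) hle

end Modular

/-! ### Cluster fractions after secret row permutations -/

section HiddenFraction

variable {X : Type*} [Fintype X] [DecidableEq X] {G : Subgroup (Equiv.Perm X)}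
  {N : Type*} [Fintype N] [DecidableEq N]

/-- The vector of cluster fractions of `S` after the elements of the row `{i} × X` have been
permuted by `σ i`. -/
noncomputable def hiddenFraction (σ : N → G) (S : Finset (N × X)) : X → ℝ :=
  fun j => (∑ i, if (i, (σ i : Equiv.Perm X)⁻¹ j) ∈ S then (1 : ℝ) else 0) / Fintype.card N

/-- Exhibits the hidden fractions as a modular function of S, as `isObjective_comp_sum` requires. -/
theorem hiddenFraction_eq_sum (σ : N → G) (S : Finset (N × X)) :
    hiddenFraction σ S =
      ∑ e ∈ S, Pi.single ((σ e.1 : Equiv.Perm X) e.2) (1 / (Fintype.card N : ℝ)) := by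
  ext j
  rw [Finset.sum_apply, ← Finset.univ_inter S, ← Finset.sum_ite_mem, Fintype.sum_prod_type, hiddenFraction,
    Finset.sum_div]
  refine Finset.sum_congr rfl fun i _ => ?_
  rw [Finset.sum_eq_single ((σ i : Equiv.Perm X)⁻¹ j)]
  · simp [ite_div]
  · intro k _ hk
    have : j ≠ (σ i : Equiv.Perm X) k := fun h => hk (by rw [h]; simp)
    simp [this]
  · simp

theorem clusterFraction_eq_hiddenFraction (S : Finset (N × X)) :
    clusterFraction N S = hiddenFraction (fun _ => (1 : G)) S := by
  ext j
  unfold clusterFraction hiddenFraction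
  congr 1
  rw [Finset.sum_boole]
  norm_cast
  refine Finset.card_bij' (fun e _ => e.1) (fun i _ => (i, j)) ?_ ?_ ?_ ?_
  · rintro ⟨i, k⟩ h
    simp only [Finset.mem_filter] at h
    obtain ⟨h, rfl⟩ := h
    simpa using h
  · intro i h
    simpa using h
  · rintro ⟨i, k⟩ h
    simp only [Finset.mem_filter] at h
    rw [h.2]
  · intro i _
    rfl

theorem sum_single_div_card_le_one (σ : N → G) :
    ∑ e : N × X, (Pi.single ((σ e.1 : Equiv.Perm X) e.2) (1 / (Fintype.card N : ℝ)) : X → ℝ) ≤ 1 := by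
  rw [← hiddenFraction_eq_sum]
  intro j
  simp only [hiddenFraction, Finset.mem_univ, if_true, Finset.sum_const, Finset.card_univ,
    nsmul_eq_mul, mul_one, Pi.one_apply]
  exact div_self_le_one _

theorem single_div_card_nonneg (k : X) :
    (0 : X → ℝ) ≤ Pi.single k (1 / (Fintype.card N : ℝ)) :=
  Pi.single_nonneg.2 (by positivity)

theorem hiddenFraction_nonneg (σ : N → G) (S : Finset (N × X)) : 0 ≤ hiddenFraction σ S := by
  rw [hiddenFraction_eq_sum]
  exact Finset.sum_nonneg fun e _ => single_div_card_nonneg _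

theorem hiddenFraction_le_one (σ : N → G) (S : Finset (N × X)) : hiddenFraction σ S ≤ 1 := by
  refine le_trans ?_ (sum_single_div_card_le_one σ)
  rw [hiddenFraction_eq_sum]
  exact Finset.sum_le_sum_of_subset_of_nonneg (Finset.subset_univ S)
    fun e _ _ => single_div_card_nonneg _

theorem symmetrize_finset_sum {ι : Type*} (s : Finset ι) (w : ι → X → ℝ) :
    symmetrize G (∑ e ∈ s, w e) = ∑ e ∈ s, symmetrize G (w e) :=
  map_sum (IsLinearMap.mk' (symmetrize G) ⟨symmetrize_add G, symmetrize_smul G⟩) w s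

theorem symmetrize_comp_inv (x : X → ℝ) {τ : Equiv.Perm X} (hτ : τ ∈ G) :
    symmetrize G (fun j => x (τ⁻¹ j)) = symmetrize G x := by
  classical
  ext j
  simp only [symmetrize_apply]
  congr 1
  refine Fintype.sum_equiv (Equiv.mulRight (⟨τ, hτ⟩ : G)) _ _ fun σ => ?_
  simp

theorem symmetrize_single_perm (τ : G) (k : X) (c : ℝ) :
    symmetrize G (Pi.single ((τ : Equiv.Perm X) k) c) = symmetrize G (Pi.single k c) := by
  rw [← symmetrize_comp_inv (Pi.single k c) τ.2]
  congr 1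
  ext j
  simp only [Pi.single_apply, Equiv.Perm.inv_def, Equiv.symm_apply_eq]

/-- Each element contributes a multiple of a unit vector, and σ moves that vector only within its
G-orbit, which symmetrization does not see. Hence a single function g serves all σ. -/
theorem symmetrize_hiddenFraction (σ : N → G) (S : Finset (N × X)) :
    symmetrize G (hiddenFraction σ S) = symmetrize G (clusterFraction N S) := by
  rw [clusterFraction_eq_hiddenFraction (G := G), hiddenFraction_eq_sum, hiddenFraction_eq_sum,
    symmetrize_finset_sum, symmetrize_finset_sum]
  refine Finset.sum_congr rfl fun e _ => ?_
  rw [symmetrize_single_perm, symmetrize_single_perm]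

theorem symmetrize_charVec_map (S : Finset X) {τ : Equiv.Perm X} (hτ : τ ∈ G) :
    symmetrize G (charVec (S.map τ.toEmbedding)) = symmetrize G (charVec S) := by
  rw [← symmetrize_comp_inv (charVec S) hτ]
  congr 1
  ext j
  simp [charVec]

theorem isObjective_comp_hiddenFraction {mono : Prop}
    {Φ : (X → ℝ) → ℝ} (hnn : ∀ x, 0 ≤ x → x ≤ 1 → 0 ≤ Φ x)
    (hdr : ∀ x u v, 0 ≤ x → 0 ≤ u → 0 ≤ v → x + u + v ≤ 1 →
      Φ (x + u + v) + Φ x ≤ Φ (x + u) + Φ (x + v))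
    (hmono : mono → ∀ x u, 0 ≤ x → 0 ≤ u → x + u ≤ 1 → Φ x ≤ Φ (x + u)) (σ : N → G) :
    IsObjective mono (fun S : Finset (N × X) => Φ (hiddenFraction σ S)) := by
  simp only [hiddenFraction_eq_sum]
  exact isObjective_comp_sum hnn hdr hmono (fun e => single_div_card_nonneg _)
    (sum_single_div_card_le_one σ)

theorem isObjective_comp_symmetrize_clusterFraction {mono : Prop}
    {Φ : (X → ℝ) → ℝ} (hnn : ∀ x, 0 ≤ x → x ≤ 1 → 0 ≤ Φ x)
    (hdr : ∀ x u v, 0 ≤ x → 0 ≤ u → 0 ≤ v → x + u + v ≤ 1 →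
      Φ (x + u + v) + Φ x ≤ Φ (x + u) + Φ (x + v))
    (hmono : mono → ∀ x u, 0 ≤ x → 0 ≤ u → x + u ≤ 1 → Φ x ≤ Φ (x + u)) :
    IsObjective mono (fun S : Finset (N × X) => Φ (symmetrize G (clusterFraction N S))) := by
  simp only [clusterFraction_eq_hiddenFraction (G := G), hiddenFraction_eq_sum,
    symmetrize_finset_sum]
  refine isObjective_comp_sum hnn hdr hmono
    (fun e => symmetrize_nonneg G (single_div_card_nonneg _)) ?_
  rw [← symmetrize_finset_sum]
  exact symmetrize_le_one G (sum_single_div_card_le_one (G := G) fun _ => 1)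

/-- Writes the deviation as an average over the rows, where row i contributes a function of σ i
alone, centred over G. This is the form to which the concentration bound applies. -/
theorem hiddenFraction_sub_symmetrize [Fintype G] (σ : N → G) (S : Finset (N × X)) (j : X) :
    hiddenFraction σ S j - symmetrize G (hiddenFraction σ S) j =
      (∑ i, ((if (i, (σ i : Equiv.Perm X)⁻¹ j) ∈ S then (1 : ℝ) else 0) -
        (∑ τ : G, if (i, (τ : Equiv.Perm X)⁻¹ j) ∈ S then (1 : ℝ) else 0) / Fintype.card G)) /
        Fintype.card N := by
  rw [Finset.sum_sub_distrib, sub_div, symmetrize_hiddenFraction,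
    clusterFraction_eq_hiddenFraction (G := G), symmetrize_apply]
  congr 1
  simp only [hiddenFraction, ← Finset.sum_div]
  rw [Finset.sum_comm, div_right_comm]
  simp

/-- A set whose hidden fractions are far from symmetric is exponentially unlikely. -/
theorem card_sqAsymmetry_hiddenFraction_le [Fintype G] [Nonempty N] {t δ : ℝ} (ht : 0 ≤ t)
    (ht2 : t ≤ 2) (hδ : Fintype.card X * t ^ 2 ≤ δ) (S : Finset (N × X)) :
    (Nat.card {σ : N → G // ¬ sqAsymmetry G (hiddenFraction σ S) ≤ δ} : ℝ) ≤
      (Fintype.card X * 2 * Real.exp (-(t ^ 2 / 4) * Fintype.card N)) *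
        Fintype.card (N → G) := by
  classical
  set Y : X → N → G → ℝ := fun j i τ => if (i, (τ : Equiv.Perm X)⁻¹ j) ∈ S then 1 else 0 with hY
  set Z : X → N → G → ℝ := fun j i τ => Y j i τ - (∑ τ', Y j i τ') / Fintype.card G with hZ
  have hG : (0 : ℝ) < Fintype.card G := Nat.cast_pos.2 Fintype.card_pos
  have hN : (0 : ℝ) < Fintype.card N := Nat.cast_pos.2 Fintype.card_pos
  have hY0 : ∀ j i τ, 0 ≤ Y j i τ := fun j i τ => by simp only [hY]; split_ifs <;> norm_num
  have hY1 : ∀ j i τ, Y j i τ ≤ 1 := fun j i τ => by simp only [hY]; split_ifs <;> norm_num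
  have hZ1 : ∀ j i τ, |Z j i τ| ≤ 1 := fun j i τ => by
    have a : 0 ≤ (∑ τ', Y j i τ') / Fintype.card G :=
      div_nonneg (Finset.sum_nonneg fun τ' _ => hY0 j i τ') hG.le
    have b : (∑ τ', Y j i τ') / Fintype.card G ≤ 1 := by
      rw [div_le_one hG]
      simpa using Finset.sum_le_sum fun τ' (_ : τ' ∈ Finset.univ) => hY1 j i τ'
    rw [abs_le]
    constructor <;> simp only [hZ] <;> linarith [hY0 j i τ, hY1 j i τ]
  have hZsum : ∀ j i, ∑ τ, Z j i τ = 0 := fun j i => by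
    simp only [hZ, Finset.sum_sub_distrib, Finset.sum_const, Finset.card_univ, nsmul_eq_mul]
    rw [mul_div_cancel₀ _ hG.ne', sub_self]
  -- Union bound over coordinates: if all of them deviate by less than t, the squared asymmetry is
  -- at most |X| t² ≤ δ.
  have hcover : (Finset.univ.filter fun σ : N → G => ¬ sqAsymmetry G (hiddenFraction σ S) ≤ δ) ⊆
      Finset.univ.biUnion fun j => Finset.univ.filter fun σ : N → G =>
        t * Fintype.card N ≤ |∑ i, Z j i (σ i)| := by
    intro σ hσ
    simp only [Finset.mem_biUnion, Finset.mem_filter, Finset.mem_univ, true_and] at hσ ⊢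
    by_contra! h
    refine hσ (le_trans ?_ hδ)
    have : sqAsymmetry G (hiddenFraction σ S) ≤ ∑ _j : X, t ^ 2 := by
      refine Finset.sum_le_sum fun j _ => ?_
      rw [hiddenFraction_sub_symmetrize, sq_le_sq, abs_of_nonneg ht, abs_div, abs_of_pos hN,
        div_le_iff₀ hN]
      exact (h j).le
    simpa using this
  rw [Nat.card_eq_fintype_card, Fintype.card_subtype]
  calc _ ≤ ((∑ j : X, (Finset.univ.filter fun σ : N → G =>
          t * Fintype.card N ≤ |∑ i, Z j i (σ i)|).card : ℕ) : ℝ) :=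
        Nat.cast_le.2 ((Finset.card_le_card hcover).trans Finset.card_biUnion_le)
    _ ≤ ∑ _j : X, 2 * ((Fintype.card G : ℝ) ^ Fintype.card N *
          Real.exp (-(t ^ 2 / 4) * Fintype.card N)) := by
        rw [Nat.cast_sum]
        refine Finset.sum_le_sum fun j _ => ?_
        have := card_abs_le_of_sum_eq_zero (Z j) (hZ1 j) (hZsum j) ht ht2
        rwa [Nat.card_eq_fintype_card, Fintype.card_subtype] at this
    _ = _ := by
        rw [Fintype.card_fun]
        simp
        ring

end HiddenFraction

/-! ### Decision trees that cannot tell two oracles apart -/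

section Indistinguishability

variable {E : Type*}

/-- The run of the tree with oracle `h` ends with another set than the run with oracle `g`, or the
two oracles disagree on the value of the returned set. -/
def QueryTree.Distinguishes (t : QueryTree E) (g h : Finset E → ℝ) : Prop :=
  t.result h ≠ t.result g ∨ h (t.result g) ≠ g (t.result g)

/-- A decision tree distinguishes `g` from few of the oracles `h σ`, if each single query does. -/
theorem QueryTree.card_distinguishes_le {ι : Type*} [Fintype ι] (g : Finset E → ℝ)
    (h : ι → Finset E → ℝ) {B : ℝ} (hB : ∀ Q, (Nat.card {σ // h σ Q ≠ g Q} : ℝ) ≤ B)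
    (t : QueryTree E) :
    (Nat.card {σ // t.Distinguishes g (h σ)} : ℝ) ≤ (t.cost g + 1) * B := by
  classical
  simp only [Nat.card_eq_fintype_card, Fintype.card_subtype] at hB ⊢
  induction t with
  -- The returned set counts as one further query; hence the `+ 1` in the bound.
  | output S => simpa [Distinguishes, result, cost] using hB S
  | query Q next ih =>
    -- If the answers to Q agree, both runs continue in the same subtree, so only its count along
    -- the run on g is needed.
    have hsub : (Finset.univ.filter fun σ => (query Q next).Distinguishes g (h σ)) ⊆
        (Finset.univ.filter fun σ => h σ Q ≠ g Q) ∪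
          Finset.univ.filter fun σ => (next (g Q)).Distinguishes g (h σ) := by
      intro σ hσ
      simp only [Finset.mem_union, Finset.mem_filter, Finset.mem_univ, true_and] at hσ ⊢
      by_cases hQ : h σ Q = g Q
      · right
        simpa only [Distinguishes, result, hQ] using hσ
      · exact Or.inl hQ
    have h1 : ((_ : ℕ) : ℝ) ≤ _ :=
      Nat.cast_le.2 ((Finset.card_le_card hsub).trans (Finset.card_union_le _ _))
    have h2 := ih (g Q)
    have h3 := hB Q
    simp only [cost]
    push_cast at h1 ⊢
    linarith

namespace RandomizedAlgorithm

variable [Fintype E]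

/-- There are finitely many pairs of possible results, so the event is a finite union of events that
are measurable by assumption. -/
theorem measurableSet_results (A : RandomizedAlgorithm E) (g h : Finset E → ℝ)
    (p : Finset E → Finset E → Prop) :
    let := A.measΩ
    MeasurableSet {ω | p ((A.tree ω).result g) ((A.tree ω).result h)} := by
  let := A.measΩ
  have : {ω | p ((A.tree ω).result g) ((A.tree ω).result h)} =
      ⋃ S : Finset E, ⋃ T : Finset E, ⋃ _ : p S T,
        {ω | (A.tree ω).result g = S} ∩ {ω | (A.tree ω).result h = T} := by
    ext ω
    simp only [Set.mem_iUnion, Set.mem_inter_iff, Set.mem_ofPred_eq, exists_prop]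
    constructor
    · exact fun hp => ⟨_, _, hp, rfl, rfl⟩
    · rintro ⟨S, T, hp, rfl, rfl⟩
      exact hp
  rw [this]
  exact MeasurableSet.iUnion fun S => MeasurableSet.iUnion fun T => MeasurableSet.iUnion fun _ =>
    (A.measurable_result g S).inter (A.measurable_result h T)

/-- Some oracle of a family that is hard to distinguish from `g` is not distinguished from `g` by
a randomized algorithm making few queries, except with small probability. -/
theorem exists_prob_distinguishes_le {ι : Type*} [Fintype ι] [Nonempty ι]
    (A : RandomizedAlgorithm E) (g : Finset E → ℝ) (h : ι → Finset E → ℝ) {q : ℝ}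
    (hq : ∀ Q, (Nat.card {σ // h σ Q ≠ g Q} : ℝ) ≤ q * Fintype.card ι) :
    ∃ σ, A.P {ω | (A.tree ω).Distinguishes g (h σ)} ≤
      (A.expectedQueries g + 1) * ENNReal.ofReal q := by
  classical
  let := A.measΩ
  have := A.isProb
  have hmeas : ∀ σ, MeasurableSet {ω | (A.tree ω).Distinguishes g (h σ)} := fun σ =>
    A.measurableSet_results (h σ) g fun S T => S ≠ T ∨ h σ T ≠ g T
  -- Exchanging the sum over σ with the integral over seeds reduces the claim to the counting bound
  -- for each tree; some σ is then at most average.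
  have hsum : ∑ σ, A.P {ω | (A.tree ω).Distinguishes g (h σ)} ≤
      ∑ _σ : ι, (A.expectedQueries g + 1) * ENNReal.ofReal q := by
    calc _ = ∑ σ, ∫⁻ ω, {ω | (A.tree ω).Distinguishes g (h σ)}.indicator 1 ω ∂A.P :=
          Finset.sum_congr rfl fun σ _ => (MeasureTheory.lintegral_indicator_one (hmeas σ)).symm
      _ = ∫⁻ ω, ∑ σ, {ω | (A.tree ω).Distinguishes g (h σ)}.indicator 1 ω ∂A.P :=
          (MeasureTheory.lintegral_finsetSum _ fun σ _ =>
            measurable_one.indicator (hmeas σ)).symm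
      _ ≤ ∫⁻ ω, (((A.tree ω).cost g : ℝ≥0∞) + 1) *
            ENNReal.ofReal (q * Fintype.card ι) ∂A.P := by
          refine MeasureTheory.lintegral_mono fun ω => ?_
          have hc := (A.tree ω).card_distinguishes_le g h hq
          have hs : ∑ σ, {ω | (A.tree ω).Distinguishes g (h σ)}.indicator (1 : A.Ω → ℝ≥0∞) ω =
              ENNReal.ofReal (Nat.card {σ // (A.tree ω).Distinguishes g (h σ)}) := by
            simp only [Set.indicator_apply, Set.mem_ofPred_eq, Pi.one_apply]
            rw [Finset.sum_boole, Nat.card_eq_fintype_card, Fintype.card_subtype,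
              ENNReal.ofReal_natCast]
          rw [hs]
          refine (ENNReal.ofReal_le_ofReal hc).trans_eq ?_
          rw [ENNReal.ofReal_mul (by positivity), ENNReal.ofReal_add (by positivity) zero_le_one,
            ENNReal.ofReal_natCast, ENNReal.ofReal_one]
      _ = (A.expectedQueries g + 1) * ENNReal.ofReal (q * Fintype.card ι) := by
          rw [MeasureTheory.lintegral_mul_const' _ _ ENNReal.ofReal_ne_top,
            MeasureTheory.lintegral_add_right _ measurable_const]
          simp [expectedQueries]
      _ = _ := by
          rw [Finset.sum_const, Finset.card_univ, nsmul_eq_mul,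
            ENNReal.ofReal_mul' (Nat.cast_nonneg _), ENNReal.ofReal_natCast]
          ring
  obtain ⟨σ, -, hσ⟩ := ENNReal.exists_le_of_sum_le Finset.univ_nonempty hsum
  exact ⟨σ, hσ⟩

end RandomizedAlgorithm

end Indistinguishability

/-! ### Hiding feasible sets in the rows -/

section Rounding

open Filter Topology

variable {X : Type*} [Fintype X] [DecidableEq X]

/-- Every point of the polytope is a limit of averages of `n` characteristic vectors of feasible
sets. -/
theorem eventually_exists_average_mem {ℱ : Set (Finset X)} {x : X → ℝ} (hx : x ∈ polytope ℱ)
    {U : Set (X → ℝ)} (hU : U ∈ 𝓝 x) :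
    ∀ᶠ n : ℕ in atTop, ∃ R : Fin n → Finset X, (∀ i, R i ∈ ℱ) ∧
      (n : ℝ)⁻¹ • ∑ i, charVec (R i) ∈ U := by
  classical
  obtain ⟨ι, _, w, z, hw0, hw1, hz, hx⟩ := mem_convexHull_iff_exists_fintype.1 hx
  choose T hT hTz using hz
  obtain ⟨i₀⟩ : Nonempty ι := by
    by_contra h
    rw [not_nonempty_iff] at h
    simp at hw1
  -- The convex weights are rounded down to multiples of 1/n, and the leftover rows are filled with
  -- i₀; their share tends to zero.
  set c : ℕ → ι → ℕ := fun n i => ⌊w i * n⌋₊ with hc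
  have hcn : ∀ n, ∑ i, c n i ≤ n := fun n => by
    have : (∑ i, (c n i : ℝ)) ≤ ∑ i, w i * n :=
      Finset.sum_le_sum fun i _ => Nat.floor_le (mul_nonneg (hw0 i) (Nat.cast_nonneg n))
    rw [← Finset.sum_mul, hw1, one_mul] at this
    exact_mod_cast this
  have hlim : ∀ i, Tendsto (fun n : ℕ => (n : ℝ)⁻¹ * c n i) atTop (𝓝 (w i)) := fun i => by
    have := (tendsto_nat_floor_mul_div_atTop (hw0 i)).comp tendsto_natCast_atTop_atTop
    simpa only [Function.comp_def, div_eq_inv_mul] using this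
  have hlim' : Tendsto (fun n : ℕ => ∑ i, ((n : ℝ)⁻¹ * c n i) • z i +
      (1 - ∑ i, (n : ℝ)⁻¹ * c n i) • z i₀) atTop (𝓝 x) := by
    have h1 := tendsto_finsetSum Finset.univ fun i _ => (hlim i).smul_const (z i)
    have h2 := tendsto_finsetSum Finset.univ fun i _ => hlim i
    have h3 := h1.add ((h2.const_sub 1).smul_const (z i₀))
    simpa [hw1, hx] using h3
  filter_upwards [hlim' hU, eventually_gt_atTop 0] with n hn hn0
  have hcard : Fintype.card (Fin n) =
      Fintype.card ((Σ i, Fin (c n i)) ⊕ Fin (n - ∑ i, c n i)) := by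
    simp [Nat.add_sub_cancel' (hcn n)]
  let e := Fintype.equivOfCardEq hcard
  refine ⟨fun a => T (Sum.elim (fun b => b.1) (fun _ => i₀) (e a)), fun a => hT _, ?_⟩
  convert Set.mem_preimage.1 hn using 1
  simp only [hTz]
  rw [e.sum_comp (fun b => z (Sum.elim (fun b => b.1) (fun _ => i₀) b)), Fintype.sum_sum_type,
    Fintype.sum_sigma]
  have hn' : (n : ℝ) ≠ 0 := Nat.cast_ne_zero.2 hn0.ne'
  simp only [Sum.elim_inl, Sum.elim_inr, Finset.sum_const, Finset.card_univ, Fintype.card_fin,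
    smul_add, Finset.smul_sum, ← Nat.cast_smul_eq_nsmul ℝ, smul_smul]
  congr 2
  rw [Nat.cast_sub (hcn n), ← Finset.mul_sum, mul_sub, inv_mul_cancel₀ hn']
  push_cast
  rfl

variable {G : Subgroup (Equiv.Perm X)}

/-- Hiding feasible sets in the rows yields a feasible set of the refinement. -/
theorem exists_mem_refinement_hiddenFraction_eq {n : ℕ} (hn : n ≠ 0) {f : Finset X → ℝ}
    {ℱ : Set (Finset X)} (hsymm : StronglySymmetric f ℱ G) {R : Fin n → Finset X}
    (hR : ∀ i, R i ∈ ℱ) (σ : Fin n → G) :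
    ∃ S ∈ refinement (Fin n) ℱ, hiddenFraction σ S = (n : ℝ)⁻¹ • ∑ i, charVec (R i) := by
  -- Row i is the preimage of R i under σ i. Strong symmetry makes these preimages feasible, so the
  -- visible fractions lie in the polytope, while the hidden permutation restores the sets R i.
  refine ⟨Finset.univ.filter fun e => (σ e.1 : Equiv.Perm X) e.2 ∈ R e.1, ?_, ?_⟩
  · have h : clusterFraction (Fin n)
        (Finset.univ.filter fun e : Fin n × X => (σ e.1 : Equiv.Perm X) e.2 ∈ R e.1) =
        ∑ i, (n : ℝ)⁻¹ • charVec ((R i).map (σ i : Equiv.Perm X)⁻¹.toEmbedding) := by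
      ext j
      rw [clusterFraction_eq_hiddenFraction (G := G)]
      simp only [hiddenFraction, Finset.sum_apply, Pi.smul_apply, smul_eq_mul, ← Finset.mul_sum,
        Fintype.card_fin, div_eq_inv_mul]
      congr 1
      refine Finset.sum_congr rfl fun i _ => ?_
      simp [charVec, Equiv.Perm.inv_def]
    rw [refinement, Set.mem_ofPred_eq, h]
    refine (convex_convexHull ℝ _).sum_mem (fun _ _ => by positivity) ?_ fun i _ =>
      subset_convexHull ℝ _ ⟨_, ?_, rfl⟩
    · simp [hn]
    · exact (hsymm.2 _ _ (symmetrize_charVec_map (R i) (inv_mem (σ i).2))).2 (hR i)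
  · ext j
    simp [hiddenFraction, charVec, div_eq_inv_mul]

end Rounding

/-! ### The two optima -/

section Optima

variable {X : Type*} [Fintype X] [DecidableEq X] {G : Subgroup (Equiv.Perm X)}
  {f : Finset X → ℝ} {ℱ : Set (Finset X)}

theorem polytope_subset_Icc (ℱ : Set (Finset X)) : polytope ℱ ⊆ Set.Icc 0 1 := by
  refine convexHull_min ?_ (convex_Icc 0 1)
  rintro _ ⟨S, -, rfl⟩
  constructor <;> intro j <;> simp only [charVec] <;> split_ifs <;> simp

theorem abs_multilinearExt_le_sum (f : Finset X → ℝ) {x : X → ℝ} (h0 : 0 ≤ x) (h1 : x ≤ 1) :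
    |multilinearExt f x| ≤ ∑ S, |f S| :=
  abs_multilinearExt_le (fun S => Finset.single_le_sum (f := fun S => |f S|)
    (fun _ _ => abs_nonneg _) (Finset.mem_univ S)) h0 h1

theorem exists_mem_polytope_lt (hopt : 0 < opt f ℱ) {a : ℝ} (ha : a < opt f ℱ) :
    ∃ x ∈ polytope ℱ, a < multilinearExt f x := by
  have hne : (multilinearExt f '' polytope ℱ).Nonempty := by
    by_contra h
    rw [Set.not_nonempty_iff_eq_empty] at h
    rw [opt, h, Real.sSup_empty] at hopt
    exact hopt.false
  obtain ⟨_, ⟨x, hx, rfl⟩, hax⟩ := exists_lt_of_lt_csSup hne ha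
  exact ⟨x, hx, hax⟩

theorem multilinearExt_symmetrize_le_symOpt {x : X → ℝ} (hx : x ∈ polytope ℱ) :
    multilinearExt f (symmetrize G x) ≤ symOpt f ℱ G := by
  refine le_csSup ⟨∑ S, |f S|, ?_⟩ ⟨x, hx, rfl⟩
  rintro _ ⟨y, hy, rfl⟩
  have := polytope_subset_Icc ℱ hy
  exact (le_abs_self _).trans (abs_multilinearExt_le_sum f (symmetrize_nonneg G this.1)
    (symmetrize_le_one G this.2))

theorem symmetrize_pos {x : X → ℝ} (h0 : 0 ≤ x) {i : X} (hi : 0 < x i) :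
    0 < symmetrize G x i := by
  classical
  rw [symmetrize_apply]
  refine div_pos (Finset.sum_pos' (fun σ _ => h0 _) ⟨1, Finset.mem_univ _, ?_⟩)
    (Nat.cast_pos.2 Fintype.card_pos)
  simpa using hi

theorem weight_symmetrize_pos {S : Finset X} {x : X → ℝ} (h0 : 0 ≤ x) (h1 : x ≤ 1)
    (hw : weight S x ≠ 0) : 0 < weight S (symmetrize G x) := by
  have hne := fun i => Finset.prod_ne_zero_iff.1 hw i (Finset.mem_univ i)
  refine Finset.prod_pos fun i _ => ?_
  have hi := hne i
  split_ifs at hi ⊢ with h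
  · exact symmetrize_pos h0 (lt_of_le_of_ne (h0 i) hi.symm)
  · have hs : symmetrize G (1 - x) = 1 - symmetrize G x := by
      rw [sub_eq_add_neg, ← neg_one_smul ℝ x, symmetrize_add, symmetrize_smul, symmetrize_one,
        neg_one_smul, ← sub_eq_add_neg]
    have := symmetrize_pos (G := G) (x := 1 - x) (sub_nonneg.2 h1) (i := i)
      (lt_of_le_of_ne (sub_nonneg.2 (h1 i)) hi.symm)
    rwa [hs] at this

/-- Symmetrization keeps positive coordinates positive and coordinates below 1 below 1, so a set
that contributes to F(x) also contributes to F(x̄). Positivity is essential: with a zero gap the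
factor 1 + ε would separate nothing. -/
theorem symOpt_pos (hf : ∀ S, 0 ≤ f S) (hopt : 0 < opt f ℱ) : 0 < symOpt f ℱ G := by
  obtain ⟨x, hx, hpos⟩ := exists_mem_polytope_lt hopt hopt
  obtain ⟨h0, h1⟩ := polytope_subset_Icc ℱ hx
  refine lt_of_lt_of_le ?_ (multilinearExt_symmetrize_le_symOpt hx)
  rw [multilinearExt_eq_sum_weight] at hpos ⊢
  obtain ⟨S, -, hS⟩ := Finset.exists_ne_zero_of_sum_ne_zero hpos.ne'
  refine Finset.sum_pos' (fun T _ => mul_nonneg (hf T) (weight_nonneg T (symmetrize_nonneg G h0)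
    (symmetrize_le_one G h1))) ⟨S, Finset.mem_univ S, ?_⟩
  exact mul_pos (lt_of_le_of_ne (hf S) (left_ne_zero_of_mul hS).symm)
    (weight_symmetrize_pos h0 h1 (right_ne_zero_of_mul hS))

end Optima

/-! ### The hard instances -/

section HardInstances

open Filter Topology

variable {X : Type*} [Fintype X] [DecidableEq X] {G : Subgroup (Equiv.Perm X)}
  {f : Finset X → ℝ} {ℱ : Set (Finset X)}

/-- There is an instance with optimum close to the symmetric optimum that each query, except with
exponentially small probability, fails to distinguish from a random instance whose optimum is close
to the optimum of `f`. -/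
theorem exists_hard_instances {mono : Prop} (hf : IsObjective mono f)
    (hsymm : StronglySymmetric f ℱ G) (hopt : 0 < opt f ℱ) {η : ℝ} (hη : 0 < η) :
    ∃ c : ℝ, 0 < c ∧ ∃ M : ℝ, 0 ≤ M ∧ ∃ n₀ : ℕ, ∀ n : ℕ, n₀ ≤ n →
      ∃ g : Finset (Fin n × X) → ℝ, IsObjective mono g ∧
        (∀ S ∈ refinement (Fin n) ℱ, g S ≤ symOpt f ℱ G + η) ∧
        ∃ h : (Fin n → G) → Finset (Fin n × X) → ℝ,
          (∀ σ, IsObjective mono (h σ) ∧ (∀ S, h σ S ≤ M) ∧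
            opt f ℱ - η ≤ optValue (h σ) (refinement (Fin n) ℱ)) ∧
          ∀ Q, (Nat.card {σ // h σ Q ≠ g Q} : ℝ) ≤
            Fintype.card X * 2 * Real.exp (-(2 * c) * n) * Nat.card (Fin n → G) := by
  classical
  obtain ⟨δ, hδ, Φ, hnn, happ, hdr, hmono, heq⟩ :=
    exists_symmetric_perturbation hf hsymm.1 (half_pos hη)
  set m : ℝ := (Fintype.card X : ℝ) with hm
  have hm0 : 0 ≤ m := Nat.cast_nonneg _
  -- As t ≤ 1 gives t² ≤ t, this choice yields m t² ≤ δ; it also meets the restriction t ≤ 2 of the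
  -- concentration bound.
  set t : ℝ := min 1 (δ / (m + 1)) with ht
  have ht0 : 0 < t := by positivity
  have ht1 : t ≤ 1 := min_le_left _ _
  have htδ : m * t ^ 2 ≤ δ := by
    have h1 : t * (m + 1) ≤ δ := (le_div_iff₀ (by positivity)).1 (min_le_right _ _)
    nlinarith [mul_nonneg hm0 ht0.le]
  -- Half of the Hoeffding exponent t²/4 is kept as c; the other half will pay for exp(cn) queries.
  refine ⟨t ^ 2 / 8, by positivity, ∑ S, |f S| + η, by positivity, ?_⟩
  obtain ⟨x, hx, hxopt⟩ := exists_mem_polytope_lt hopt (sub_lt_self (opt f ℱ) (half_pos hη))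
  have hrows := eventually_exists_average_mem hx
    ((isOpen_lt continuous_const (continuous_multilinearExt f)).mem_nhds hxopt)
  obtain ⟨n₀, hn₀⟩ := eventually_atTop.1 (hrows.and (eventually_gt_atTop 0))
  refine ⟨n₀, fun n hn => ?_⟩
  obtain ⟨⟨R, hR, hRopt⟩, hn0⟩ := hn₀ n hn
  have : Nonempty (Fin n) := ⟨⟨0, hn0⟩⟩
  refine ⟨fun S => Φ (symmetrize G (clusterFraction (Fin n) S)),
    isObjective_comp_symmetrize_clusterFraction hnn hdr hmono, fun S hS => ?_,
    fun σ S => Φ (hiddenFraction σ S), fun σ =>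
      ⟨isObjective_comp_hiddenFraction hnn hdr hmono σ, fun S => ?_, ?_⟩, fun Q => ?_⟩
  · have hcube := polytope_subset_Icc ℱ hS
    have h1 := (abs_le.1 (happ _ (symmetrize_nonneg G hcube.1) (symmetrize_le_one G hcube.2))).2
    have h2 : multilinearExt f (symmetrize G (clusterFraction (Fin n) S)) ≤ symOpt f ℱ G :=
      multilinearExt_symmetrize_le_symOpt hS
    linarith
  · have h0 := hiddenFraction_nonneg σ S
    have h1 := hiddenFraction_le_one σ S
    have h2 := (abs_le.1 (happ _ h0 h1)).2
    have h3 := (le_abs_self _).trans (abs_multilinearExt_le_sum f h0 h1)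
    linarith
  · obtain ⟨S, hS, hSR⟩ := exists_mem_refinement_hiddenFraction_eq hn0.ne' hsymm hR σ
    refine le_csSup_of_le (Set.toFinite _).bddAbove ⟨S, hS, rfl⟩ ?_
    have h2 := (abs_le.1 (happ _ (hiddenFraction_nonneg σ S) (hiddenFraction_le_one σ S))).1
    rw [← hSR] at hRopt
    have h3 : opt f ℱ - η / 2 < multilinearExt f (hiddenFraction σ S) := hRopt
    linarith
  · have h1 := card_sqAsymmetry_hiddenFraction_le (G := G) ht0.le (by linarith) htδ Q
    rw [Fintype.card_fin] at h1
    rw [show -(2 * (t ^ 2 / 8)) = -(t ^ 2 / 4) by ring,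
      Nat.card_eq_fintype_card (α := Fin n → G)]
    have himp : ∀ σ : Fin n → G, Φ (hiddenFraction σ Q) ≠
        Φ (symmetrize G (clusterFraction (Fin n) Q)) →
        ¬ sqAsymmetry G (hiddenFraction σ Q) ≤ δ := fun σ hσ hle => hσ <| by
      rw [heq _ hle, symmetrize_hiddenFraction]
    have hcard := Nat.card_le_card_of_injective _ (Subtype.impEmbedding _ _ himp).injective
    exact (Nat.cast_le.2 hcard).trans h1

end HardInstances

/-! ### Consequences for approximation algorithms -/

namespace RandomizedAlgorithm

variable {E : Type*} [Fintype E] {A : RandomizedAlgorithm E} {𝓞 : Set (Finset E → ℝ)}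
  {𝓕 : Set (Finset E)} {α a b q : ℝ} {g h : Finset E → ℝ}

/-- An algorithm that makes fewer than `exp (c n)` queries distinguishes `g` from some `h σ` with
small probability only. -/
theorem exists_prob_distinguishes_le_of_expectedQueries_lt {ι : Type*} [Finite ι] [Nonempty ι]
    {h : ι → Finset E → ℝ} {c n K : ℝ} (hc : 0 ≤ c) (hn : 0 ≤ n) (hK : 0 ≤ K)
    (hh : ∀ Q, (Nat.card {σ // h σ Q ≠ g Q} : ℝ) ≤ K * Real.exp (-(2 * c) * n) * Nat.card ι)
    (hq : 2 * K * Real.exp (-(c * n)) ≤ q)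
    (hA : A.expectedQueries g < ENNReal.ofReal (Real.exp (c * n))) :
    ∃ σ, A.P {ω | (A.tree ω).Distinguishes g (h σ)} ≤ ENNReal.ofReal q := by
  have := Fintype.ofFinite ι
  simp only [Nat.card_eq_fintype_card (α := ι)] at hh
  obtain ⟨σ, hσ⟩ := A.exists_prob_distinguishes_le g h hh
  refine ⟨σ, hσ.trans ?_⟩
  calc _ ≤ (ENNReal.ofReal (Real.exp (c * n)) + 1) *
        ENNReal.ofReal (K * Real.exp (-(2 * c) * n)) := by gcongr
    _ = ENNReal.ofReal ((Real.exp (c * n) + 1) * (K * Real.exp (-(2 * c) * n))) := by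
        rw [← ENNReal.ofReal_one, ← ENNReal.ofReal_add (by positivity) zero_le_one,
          ← ENNReal.ofReal_mul (by positivity)]
    _ ≤ ENNReal.ofReal q := by
        refine ENNReal.ofReal_le_ofReal (le_trans ?_ hq)
        have h1 : (1 : ℝ) ≤ Real.exp (c * n) := Real.one_le_exp (by positivity)
        calc _ ≤ (Real.exp (c * n) + Real.exp (c * n)) *
              (K * Real.exp (-(2 * c) * n)) := by gcongr
          _ = 2 * K * (Real.exp (c * n) * Real.exp (-(2 * c) * n)) := by ring
          _ = 2 * K * Real.exp (-(c * n)) := by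
              rw [← Real.exp_add]
              congr 2
              ring

/-- An approximation algorithm succeeds on `h` only if it distinguishes `h` from an instance with
small optimum. -/
theorem IsApproxWithProb.le_prob_distinguishes {p : ℝ} (hA : A.IsApproxWithProb 𝓞 𝓕 α p)
    (hh : h ∈ 𝓞) (hα : 0 ≤ α) (hg : ∀ S ∈ 𝓕, g S ≤ a) (hb : b ≤ optValue h 𝓕) (hab : a < α * b) :
    ENNReal.ofReal p ≤ A.P {ω | (A.tree ω).Distinguishes g h} := by
  let := A.measΩ
  refine (hA h hh).trans (MeasureTheory.measure_mono ?_)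
  rintro ω ⟨hmem, hval⟩
  rw [Set.mem_ofPred_eq, QueryTree.Distinguishes]
  by_contra! hd
  have h1 := hg _ hmem
  have h2 := mul_le_mul_of_nonneg_left hb hα
  rw [hd.1] at h1 hval
  linarith [hd.2]

/-- Off the distinguishing event the run on h returns a feasible set on which h agrees with g, so
its value is at most a. On that event, of probability at most q, the value is at most M. -/
theorem IsApproxInExpectation.mul_le {M : ℝ} (hA : A.IsApproxInExpectation 𝓞 𝓕 α)
    (hh : h ∈ 𝓞) (hα : 0 ≤ α) (hg : ∀ S ∈ 𝓕, g S ≤ a) (ha : 0 ≤ a) (hb : b ≤ optValue h 𝓕)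
    (hM : 0 ≤ M) (h0 : ∀ S, 0 ≤ h S) (hhM : ∀ S, h S ≤ M) (hq0 : 0 ≤ q)
    (hq : A.P {ω | (A.tree ω).Distinguishes g h} ≤ ENNReal.ofReal q) :
    α * b ≤ a + M * q := by
  let := A.measΩ
  have := A.isProb
  obtain ⟨hmem, hval⟩ := hA h hh
  set s : Set A.Ω := {ω | (A.tree ω).Distinguishes g h} with hs
  have hmeas : MeasurableSet s :=
    A.measurableSet_results h g fun S T => S ≠ T ∨ h T ≠ g T
  have hint : MeasureTheory.Integrable (fun ω => a + s.indicator (fun _ => M) ω) A.P :=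
    (MeasureTheory.integrable_const a).add
      ((MeasureTheory.integrable_const M).indicator hmeas)
  have hle : ∫ ω, h ((A.tree ω).result h) ∂A.P ≤ ∫ ω, (a + s.indicator (fun _ => M) ω) ∂A.P := by
    refine MeasureTheory.integral_mono_of_nonneg (.of_forall fun ω => h0 _) hint ?_
    filter_upwards [hmem] with ω hω
    by_cases hd : ω ∈ s
    · rw [Set.indicator_of_mem hd]
      linarith [hhM ((A.tree ω).result h)]
    · rw [Set.indicator_of_notMem hd, add_zero]
      rw [hs, Set.mem_ofPred_eq, QueryTree.Distinguishes, not_or, not_not, not_not] at hd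
      rw [hd.1] at hω ⊢
      rw [hd.2]
      exact hg _ hω
  have hcalc : ∫ ω, (a + s.indicator (fun _ => M) ω) ∂A.P = a + M * A.P.real s := by
    rw [MeasureTheory.integral_add (MeasureTheory.integrable_const a)
      ((MeasureTheory.integrable_const M).indicator hmeas),
      MeasureTheory.integral_indicator_const _ hmeas]
    simp [mul_comm]
  have hreal : A.P.real s ≤ q := ENNReal.toReal_le_of_le_ofReal hq0 hq
  have h1 := mul_le_mul_of_nonneg_left hreal hM
  have h2 := mul_le_mul_of_nonneg_left hb hα
  linarith

end RandomizedAlgorithm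

end SymmetryGap

/-! ### Choice of constants and conclusion -/

theorem theorem1p5 {X : Type*} [Fintype X] [DecidableEq X] (mono : Prop)
    (f : Finset X → ℝ) (ℱ : Set (Finset X)) (G : Subgroup (Equiv.Perm X))
    (hf : IsObjective mono f) (hsymm : StronglySymmetric f ℱ G) (hopt : 0 < opt f ℱ)
    (ε : ℝ) (hε : 0 < ε) :
    ∃ c : ℝ, 0 < c ∧
      (∀ p : ℝ, 0 < p → ∃ n₀ : ℕ, ∀ n : ℕ, n₀ ≤ n →
        ∀ A : RandomizedAlgorithm (Fin n × X),
          A.IsApproxWithProb {g | IsObjective mono g} (refinement (Fin n) ℱ)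
            ((1 + ε) * symmetryGap f ℱ G) p →
          ∃ g : Finset (Fin n × X) → ℝ, IsObjective mono g ∧
            ENNReal.ofReal (Real.exp (c * n)) ≤ A.expectedQueries g) ∧
      (∃ n₀ : ℕ, ∀ n : ℕ, n₀ ≤ n →
        ∀ A : RandomizedAlgorithm (Fin n × X),
          A.IsApproxInExpectation {g | IsObjective mono g} (refinement (Fin n) ℱ)
            ((1 + ε) * symmetryGap f ℱ G) →
          ∃ g : Finset (Fin n × X) → ℝ, IsObjective mono g ∧
            ENNReal.ofReal (Real.exp (c * n)) ≤ A.expectedQueries g) := by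
  have hsym : 0 < symOpt f ℱ G := symOpt_pos hf.1 hopt
  set s := symOpt f ℱ G with hs
  set α := (1 + ε) * symmetryGap f ℱ G with hα
  have hαs : α * opt f ℱ = (1 + ε) * s := by
    rw [hα, symmetryGap, mul_assoc, div_mul_cancel₀ _ hopt.ne']
  have hα0 : 0 < α := mul_pos (by positivity) (div_pos hsym hopt)
  -- Then α(OPT − η) = s + 3η. One η is spent on the bound for g, one on the distinguishing event in
  -- expectation, and the third keeps the inequality strict.
  set η := ε * s / (α + 3) with hη
  have hη0 : 0 < η := by positivity
  have hηeq : η * (α + 3) = ε * s := div_mul_cancel₀ _ (by positivity)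
  have hgap : s + 2 * η < α * (opt f ℱ - η) := by
    rw [mul_sub, hαs]
    linarith
  obtain ⟨c, hc, M, hM, n₁, hhard⟩ := exists_hard_instances hf hsymm hopt hη0
  have hsmall : ∀ q : ℝ, 0 < q → ∃ n₀ : ℕ, ∀ n : ℕ, n₀ ≤ n →
      2 * (Fintype.card X * 2 : ℝ) * Real.exp (-(c * n)) ≤ q := fun q hq => by
    have h1 := (Real.tendsto_exp_neg_atTop_nhds_zero.comp
      ((tendsto_natCast_atTop_atTop (R := ℝ)).const_mul_atTop hc)).const_mul
        (2 * (Fintype.card X * 2 : ℝ))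
    rw [mul_zero] at h1
    exact Filter.eventually_atTop.1 (h1.eventually_le_const hq)
  refine ⟨c, hc, fun p hp => ?_, ?_⟩
  · obtain ⟨n₂, hn₂⟩ := hsmall (p / 2) (half_pos hp)
    refine ⟨max n₁ n₂, fun n hn A hA => ?_⟩
    obtain ⟨g, hg, hgs, h, hh, hQ⟩ := hhard n (le_of_max_le_left hn)
    refine ⟨g, hg, ?_⟩
    by_contra! hE
    obtain ⟨σ, hσ⟩ := RandomizedAlgorithm.exists_prob_distinguishes_le_of_expectedQueries_lt hc.le
      n.cast_nonneg (by positivity) hQ (hn₂ n (le_of_max_le_right hn)) hE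
    obtain ⟨hobj, -, hhopt⟩ := hh σ
    have h1 := (hA.le_prob_distinguishes hobj hα0.le hgs hhopt (by linarith)).trans hσ
    rw [ENNReal.ofReal_le_ofReal_iff (by positivity)] at h1
    linarith
  -- With this probability the values on the distinguishing event contribute at most η to the
  -- expectation.
  · obtain ⟨n₂, hn₂⟩ := hsmall (η / (M + 1)) (by positivity)
    refine ⟨max n₁ n₂, fun n hn A hA => ?_⟩
    obtain ⟨g, hg, hgs, h, hh, hQ⟩ := hhard n (le_of_max_le_left hn)
    refine ⟨g, hg, ?_⟩
    by_contra! hE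
    obtain ⟨σ, hσ⟩ := RandomizedAlgorithm.exists_prob_distinguishes_le_of_expectedQueries_lt hc.le
      n.cast_nonneg (by positivity) hQ (hn₂ n (le_of_max_le_right hn)) hE
    obtain ⟨hobj, hhM, hhopt⟩ := hh σ
    have h1 := hA.mul_le hobj hα0.le hgs (by positivity) hhopt hM hobj.1 hhM (by positivity) hσ
    have h2 : M * (η / (M + 1)) ≤ η := by
      rw [mul_div_assoc', div_le_iff₀ (by positivity)]
      nlinarith
    linarith
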